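/- Let $n\ge 0$ be an integer, $0<T<\infty$, $Q_T=\mathbb R^n\times(0,T)$ and $\overline Q_T=\mathbb R^n\times[0,T]$. Let $V\in L^1_{loc}(Q_T)$ be nonnegative, and let $\mathfrak M(\mathbb R^n)$ be the set of (signed) Radon measures on $\mathbb R^n$. Let $X(Q_T)$ be the space of functions $\phi\in C_c(\overline Q_T)$ with $\phi(\cdot,T)=0$ whose distributional derivative $\partial_t\phi+\Delta\phi$ in $Q_T$ belongs to $L^\infty_{loc}(\overline Q_T)$. For $\mu\in\mathfrak M(\mathbb R^n)$, a weak solution of $$\partial_tu-\Delta u+Vu=0\ \text{ in }Q_T,\qquad u(\cdot,0)=\mu\ \text{ in }\mathbb R^n\qquad(\ast)$$ is a function $u\in L^1_{loc}(\overline Q_T)$ with $Vu\in L^1_{loc}(\overline Q_T)$ and $$-\iint_{Q_T}u\,(\partial_t\phi+\Delta\phi)\,dx\,dt+\iint_{Q_T}Vu\,\phi\,dx\,dt=\int_{\mathbb R^n}\phi(x,0)\,d\mu(x)\qquad\text{for all }\phi\in X(Q_T).$$ The class $\mathcal E_V(Q_T)$ consists of the functions $u$ for which there is $\lambda>0$ with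 $$\iint_{Q_T}e^{-\lambda|x|^2}|u(x,t)|\,(1+V(x,t))\,dx\,dt<\infty.$$ Then for every $\mu\in\mathfrak M(\mathbb R^n)$ there is at most one weak solution of $(\ast)$ in the class $\mathcal E_V(Q_T)$: any two such solutions are equal almost everywhere in $Q_T$. Equivalently, a weak solution of $(\ast)$ with $\mu=0$ which belongs to $\mathcal E_V(Q_T)$ vanishes almost everywhere in $Q_T$. -/

import Mathlib

open MeasureTheory Set
open scoped ContDiff

noncomputable section

namespace HeatPotential

/-- Space-time `ℝⁿ × ℝ`; a point is written `(x, t)`. -/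
abbrev SpaceTime (n : ℕ) : Type := EuclideanSpace ℝ (Fin n) × ℝ

/-- The cylinder `Q_T = ℝⁿ × (0, T)`. -/
def Q (n : ℕ) (T : ℝ) : Set (SpaceTime n) := univ ×ˢ Ioo 0 T

/-- The closed cylinder `ℝⁿ × [0, T]`. -/
def closedQ (n : ℕ) (T : ℝ) : Set (SpaceTime n) := univ ×ˢ Icc 0 T

/-- A (signed) Radon measure on `ℝⁿ`, given by its Jordan decomposition `μ = μ⁺ - μ⁻`, both parts
being finite on compact sets. -/
structure SignedRadonMeasure (n : ℕ) where
  posPart : Measure (EuclideanSpace ℝ (Fin n))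
  negPart : Measure (EuclideanSpace ℝ (Fin n))
  posPart_locallyFinite : IsLocallyFiniteMeasure posPart
  negPart_locallyFinite : IsLocallyFiniteMeasure negPart
  mutuallySingular : posPart.MutuallySingular negPart

/-- The zero measure. -/
instance (n : ℕ) : Zero (SignedRadonMeasure n) where
  zero :=
    { posPart := 0
      negPart := 0
      posPart_locallyFinite := inferInstance
      negPart_locallyFinite := inferInstance
      mutuallySingular := Measure.MutuallySingular.zero_left }

/-- The integral `∫ f dμ = ∫ f dμ⁺ - ∫ f dμ⁻` (used for continuous compactly supported `f`). -/
def SignedRadonMeasure.integral {n : ℕ} (μ : SignedRadonMeasure n)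
    (f : EuclideanSpace ℝ (Fin n) → ℝ) : ℝ :=
  (∫ x, f x ∂μ.posPart) - ∫ x, f x ∂μ.negPart

/-- The time derivative `∂ₜψ`. -/
def timeDeriv {n : ℕ} (ψ : SpaceTime n → ℝ) (p : SpaceTime n) : ℝ :=
  deriv (fun s : ℝ => ψ (p.1, s)) p.2

/-- The Laplacian `Δψ` in the space variable. -/
def spaceLaplacian {n : ℕ} (ψ : SpaceTime n → ℝ) (p : SpaceTime n) : ℝ :=
  Laplacian.laplacian (fun y : EuclideanSpace ℝ (Fin n) => ψ (y, p.2)) p.1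

/-- `∂ₜφ + Δφ = g` in the sense of distributions in `Q_T`. -/
def IsBackwardHeat {n : ℕ} (T : ℝ) (φ g : SpaceTime n → ℝ) : Prop :=
  ∀ ψ : SpaceTime n → ℝ, ContDiff ℝ ∞ ψ → HasCompactSupport ψ → tsupport ψ ⊆ Q n T →
    ∫ p in Q n T, φ p * (-timeDeriv ψ p + spaceLaplacian ψ p) = ∫ p in Q n T, g p * ψ p

/-- `g ∈ L^∞_loc(ℝⁿ × [0, T])`. -/
def LocallyBoundedOn {n : ℕ} (T : ℝ) (g : SpaceTime n → ℝ) : Prop :=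
  AEStronglyMeasurable g (volume.restrict (closedQ n T)) ∧
    ∀ K : Set (SpaceTime n), IsCompact K → K ⊆ closedQ n T →
      ∃ C : ℝ, ∀ᵐ p ∂volume.restrict K, |g p| ≤ C

/-- `φ` is a test function in `X(Q_T)` and `∂ₜφ + Δφ = g`. Thus `φ` is continuous on
`ℝⁿ × [0, T]`, vanishes there outside a compact set and for `t = T`, and its distributional
derivative `∂ₜφ + Δφ` is represented by the locally bounded function `g` (unique almost
everywhere in `Q_T`). -/
structure IsTestFunction {n : ℕ} (T : ℝ) (φ g : SpaceTime n → ℝ) : Prop where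
  continuousOn : ContinuousOn φ (closedQ n T)
  compactSupport : ∃ K : Set (SpaceTime n), IsCompact K ∧ ∀ p ∈ closedQ n T, p ∉ K → φ p = 0
  final : ∀ x : EuclideanSpace ℝ (Fin n), φ (x, T) = 0
  backwardHeat : IsBackwardHeat T φ g
  locallyBounded : LocallyBoundedOn T g

/-- `u` is a weak solution of `∂ₜu - Δu + V u = 0` in `Q_T`, `u(·, 0) = μ` in `ℝⁿ`. -/
structure IsWeakSolution {n : ℕ} (T : ℝ) (V : SpaceTime n → ℝ) (μ : SignedRadonMeasure n)
    (u : SpaceTime n → ℝ) : Prop where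
  locallyIntegrable : LocallyIntegrableOn u (closedQ n T)
  locallyIntegrable_potential : LocallyIntegrableOn (fun p => V p * u p) (closedQ n T)
  weakForm : ∀ φ g : SpaceTime n → ℝ, IsTestFunction T φ g →
    -(∫ p in Q n T, u p * g p) + ∫ p in Q n T, V p * u p * φ p
      = μ.integral (fun x => φ (x, 0))

/-- The class `ℰ_V(Q_T)`. -/
def InClassE {n : ℕ} (T : ℝ) (V u : SpaceTime n → ℝ) : Prop :=
  ∃ l : ℝ, 0 < l ∧
    IntegrableOn (fun p => Real.exp (-l * ‖p.1‖ ^ 2) * |u p| * (1 + V p)) (Q n T)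

end HeatPotential

end

noncomputable section

namespace HeatPotential

/-! Let `U` be the difference of two solutions, extended by zero outside `Q n T`. Test functions
need not vanish at `t = 0`, and the two initial terms cancel, so `∂ₜU - ΔU = -VU` holds in the
distributional sense on all of `{t < T}`, across `t = 0` (`IsWeakSolution.isDistribSolution_sub`).
The potential is absorbed by Kato's inequality: since `U · VU = VU² ≥ 0`, the function `|U|` is a
subsolution of the heat equation on `{t < T}` (`IsDistribSolution.integral_abs_nonneg`). This is
proved by mollifying `U`, applying the chain rule to a smooth convex function of the mollification,
and letting that function tend to the absolute value.

A nonnegative subsolution `w` with `exp(-l|x|²) w` integrable, zero for `t ≤ 0`, must vanish.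
Suppose `w = 0` for `t < t₀`. The weight `exp(-t - a(t)|x|²)` with `a(t) = l + 16 l² (t - t₀)`
satisfies `l ≤ a ≤ 2l` for `t₀ ≤ t ≤ t₀ + 1/(16 l)`. There `a' = 16 l² ≥ 4a²`, so `∂ₜ + Δ` of the
weight is at most minus the weight. Testing with the weight times a space cutoff and a time cutoff,
and removing the space cutoff by dominated convergence, gives `0 ≤ -∫ w · weight · cutoff`. Hence `w
= 0` up to `t₀ + 1/(16 l)`, or up to any time below `T` if that comes sooner
(`IsHeatSubsolution.ae_eq_zero_step`). The step length depends only on `l`, so finitely many steps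
reach any time below `T`. -/

theorem integrable_mul_of_hasCompactSupport {α : Type*} [TopologicalSpace α] [MeasurableSpace α]
    [OpensMeasurableSpace α] {μ : Measure α} [IsFiniteMeasureOnCompacts μ] {f g : α → ℝ}
    (hf : Continuous f) (hg : Continuous g) (hgs : HasCompactSupport g) :
    Integrable (fun p => f p * g p) μ :=
  (hf.mul hg).integrable_of_hasCompactSupport hgs.mul_left

/-! ### Directional derivatives, the heat operator and integration by parts. -/

section Calculus

variable {G : Type*} [NormedAddCommGroup G] [NormedSpace ℝ G]

/-- The derivative of `f` in the direction `v`. -/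
def dirDeriv (v : G) (f : G → ℝ) (p : G) : ℝ := fderiv ℝ f p v

theorem contDiff_dirDeriv {f : G → ℝ} (hf : ContDiff ℝ ∞ f) (v : G) :
    ContDiff ℝ ∞ (dirDeriv v f) :=
  (hf.fderiv_right (m := ∞) (by simp)).clm_apply contDiff_const

theorem support_dirDeriv_subset (v : G) (f : G → ℝ) :
    Function.support (dirDeriv v f) ⊆ tsupport f := fun p hp =>
  support_fderiv_subset ℝ (f := f) fun h => hp (by simp [dirDeriv, h])

theorem tsupport_dirDeriv_subset (v : G) (f : G → ℝ) :
    tsupport (dirDeriv v f) ⊆ tsupport f :=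
  closure_minimal (support_dirDeriv_subset v f) (isClosed_tsupport f)

theorem hasCompactSupport_dirDeriv {f : G → ℝ} (hf : HasCompactSupport f) (v : G) :
    HasCompactSupport (dirDeriv v f) :=
  HasCompactSupport.of_support_subset_isCompact hf (support_dirDeriv_subset v f)

theorem dirDeriv_neg_dir (v : G) (f : G → ℝ) : dirDeriv (-v) f = fun p => -dirDeriv v f p := by
  ext p; simp [dirDeriv]

theorem dirDeriv_add (v : G) {f g : G → ℝ} (hf : ContDiff ℝ ∞ f) (hg : ContDiff ℝ ∞ g) :
    dirDeriv v (fun p => f p + g p) = fun p => dirDeriv v f p + dirDeriv v g p := by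
  ext p
  have h1 := (hf.differentiable (by simp) p)
  have h2 := (hg.differentiable (by simp) p)
  simp [dirDeriv, fderiv_fun_add h1 h2]

theorem dirDeriv_mul (v : G) {f g : G → ℝ} (hf : ContDiff ℝ ∞ f) (hg : ContDiff ℝ ∞ g) :
    dirDeriv v (fun p => f p * g p) = fun p => dirDeriv v f p * g p + f p * dirDeriv v g p := by
  ext p
  have h1 := (hf.differentiable (by simp) p)
  have h2 := (hg.differentiable (by simp) p)
  simp [dirDeriv, fderiv_fun_mul h1 h2]
  ring

theorem dirDeriv_comp (v : G) {j : ℝ → ℝ} {f : G → ℝ} (hj : ContDiff ℝ ∞ j)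
    (hf : ContDiff ℝ ∞ f) :
    dirDeriv v (fun p => j (f p)) = fun p => deriv j (f p) * dirDeriv v f p := by
  ext p
  have h1 := (hf.differentiable (by simp) p).hasFDerivAt
  have h2 := (hj.differentiable (by simp) (f p)).hasDerivAt
  have := (h2.comp_hasFDerivAt p h1).fderiv
  simp only [dirDeriv]
  rw [show (fun p => j (f p)) = j ∘ f from rfl, this]
  simp

theorem contDiff_deriv {j : ℝ → ℝ} (hj : ContDiff ℝ ∞ j) : ContDiff ℝ ∞ (deriv j) :=
  ((contDiff_infty_iff_deriv).1 hj).2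

variable {ι : Type*} [Fintype ι]

/-- The operator `D_τ + ∑ᵢ D_{eᵢ}²`. For `τ` the time direction and `eᵢ` the space directions it is
`∂ₜ + Δ`. -/
def heatOp (τ : G) (e : ι → G) (f : G → ℝ) (p : G) : ℝ :=
  dirDeriv τ f p + ∑ i, dirDeriv (e i) (dirDeriv (e i) f) p

variable (τ : G) (e : ι → G)

theorem contDiff_heatOp {f : G → ℝ} (hf : ContDiff ℝ ∞ f) : ContDiff ℝ ∞ (heatOp τ e f) :=
  (contDiff_dirDeriv hf τ).add
    (ContDiff.sum fun _ _ => contDiff_dirDeriv (contDiff_dirDeriv hf _) _)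

theorem support_heatOp_subset (f : G → ℝ) : Function.support (heatOp τ e f) ⊆ tsupport f := by
  intro p hp
  by_contra h
  have h1 : dirDeriv τ f p = 0 := by
    by_contra h'; exact h (support_dirDeriv_subset _ _ h')
  have h2 : ∀ i, dirDeriv (e i) (dirDeriv (e i) f) p = 0 := fun i => by
    by_contra h'
    exact h (tsupport_dirDeriv_subset _ _ (support_dirDeriv_subset _ _ h'))
  exact hp (by simp [heatOp, h1, h2])

theorem hasCompactSupport_heatOp {f : G → ℝ} (hf : HasCompactSupport f) :
    HasCompactSupport (heatOp τ e f) :=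
  HasCompactSupport.of_support_subset_isCompact hf (support_heatOp_subset τ e f)

theorem heatOp_mul {f g : G → ℝ} (hf : ContDiff ℝ ∞ f) (hg : ContDiff ℝ ∞ g) (p : G) :
    heatOp τ e (fun p => f p * g p) p = heatOp τ e f p * g p + f p * heatOp τ e g p
      + 2 * ∑ i, dirDeriv (e i) f p * dirDeriv (e i) g p := by
  have h : ∀ i, dirDeriv (e i) (dirDeriv (e i) (fun p => f p * g p)) p
      = dirDeriv (e i) (dirDeriv (e i) f) p * g p + f p * dirDeriv (e i) (dirDeriv (e i) g) p
        + 2 * (dirDeriv (e i) f p * dirDeriv (e i) g p) := fun i => by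
    have hf' := contDiff_dirDeriv hf (e i)
    have hg' := contDiff_dirDeriv hg (e i)
    rw [dirDeriv_mul _ hf hg, dirDeriv_add _ (hf'.mul hg) (hf.mul hg'), dirDeriv_mul _ hf' hg,
      dirDeriv_mul _ hf hg']
    ring
  simp only [heatOp, h, dirDeriv_mul τ hf hg, Finset.sum_add_distrib, ← Finset.mul_sum,
    ← Finset.sum_mul]
  ring

theorem heatOp_comp {j : ℝ → ℝ} {f : G → ℝ} (hj : ContDiff ℝ ∞ j) (hf : ContDiff ℝ ∞ f) (p : G) :
    heatOp τ e (fun p => j (f p)) p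
      = deriv j (f p) * heatOp τ e f p + deriv (deriv j) (f p) * ∑ i, dirDeriv (e i) f p ^ 2 := by
  have hj' := contDiff_deriv hj
  have h : ∀ i, dirDeriv (e i) (dirDeriv (e i) (fun p => j (f p))) p
      = deriv j (f p) * dirDeriv (e i) (dirDeriv (e i) f) p
        + deriv (deriv j) (f p) * dirDeriv (e i) f p ^ 2 := fun i => by
    rw [dirDeriv_comp _ hj hf,
      dirDeriv_mul (f := fun p => deriv j (f p)) _ (hj'.comp hf) (contDiff_dirDeriv hf _),
      dirDeriv_comp _ hj' hf]
    ring
  simp only [heatOp, h, dirDeriv_comp τ hj hf, Finset.sum_add_distrib, ← Finset.mul_sum]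
  ring

section Integral

variable [MeasurableSpace G] [BorelSpace G] [FiniteDimensional ℝ G] {μ : Measure G}
  [μ.IsAddHaarMeasure]

theorem integral_mul_dirDeriv {f g : G → ℝ} (hf : ContDiff ℝ ∞ f) (hg : ContDiff ℝ ∞ g)
    (hgs : HasCompactSupport g) (v : G) :
    ∫ p, f p * dirDeriv v g p ∂μ = -∫ p, dirDeriv v f p * g p ∂μ :=
  integral_mul_fderiv_eq_neg_fderiv_mul_of_integrable
    (integrable_mul_of_hasCompactSupport (contDiff_dirDeriv hf v).continuous hg.continuous hgs)
    (integrable_mul_of_hasCompactSupport hf.continuous (contDiff_dirDeriv hg v).continuous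
      (hasCompactSupport_dirDeriv hgs v))
    (integrable_mul_of_hasCompactSupport hf.continuous hg.continuous hgs)
    (fun x _ => hf.differentiable (by simp) x) (fun x _ => hg.differentiable (by simp) x)

/-- The first-order term changes sign under one integration by parts and the second-order terms are
symmetric, so the formal adjoint is obtained by reversing `τ`. Compact support of one factor removes
all boundary terms. -/
theorem integral_mul_heatOp {f g : G → ℝ} (hf : ContDiff ℝ ∞ f) (hg : ContDiff ℝ ∞ g)
    (hgs : HasCompactSupport g) :
    ∫ p, f p * heatOp τ e g p ∂μ = ∫ p, heatOp (-τ) e f p * g p ∂μ := by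
  have h : ∀ i, ∫ p, f p * dirDeriv (e i) (dirDeriv (e i) g) p ∂μ
      = ∫ p, dirDeriv (e i) (dirDeriv (e i) f) p * g p ∂μ := fun i => by
    rw [integral_mul_dirDeriv hf (contDiff_dirDeriv hg _) (hasCompactSupport_dirDeriv hgs _),
      integral_mul_dirDeriv (contDiff_dirDeriv hf _) hg hgs, neg_neg]
  have h0 := integral_mul_dirDeriv (μ := μ) hf hg hgs τ
  simp only [heatOp, mul_add, add_mul, Finset.mul_sum, Finset.sum_mul, dirDeriv_neg_dir, neg_mul]
  rw [integral_add, integral_add, integral_finsetSum, integral_finsetSum, h0, integral_neg,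
    Finset.sum_congr rfl fun i _ => h i]
  · exact fun i _ => integrable_mul_of_hasCompactSupport
      (contDiff_dirDeriv (contDiff_dirDeriv hf _) _).continuous hg.continuous hgs
  · exact fun i _ => integrable_mul_of_hasCompactSupport hf.continuous
      (contDiff_dirDeriv (contDiff_dirDeriv hg _) _).continuous
      (hasCompactSupport_dirDeriv (hasCompactSupport_dirDeriv hgs _) _)
  · exact (integrable_mul_of_hasCompactSupport (contDiff_dirDeriv hf _).continuous
      hg.continuous hgs).neg
  · exact integrable_finsetSum _ fun i _ => integrable_mul_of_hasCompactSupport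
      (contDiff_dirDeriv (contDiff_dirDeriv hf _) _).continuous hg.continuous hgs
  · exact integrable_mul_of_hasCompactSupport hf.continuous (contDiff_dirDeriv hg _).continuous
      (hasCompactSupport_dirDeriv hgs _)
  · exact integrable_finsetSum _ fun i _ => integrable_mul_of_hasCompactSupport hf.continuous
      (contDiff_dirDeriv (contDiff_dirDeriv hg _) _).continuous
      (hasCompactSupport_dirDeriv (hasCompactSupport_dirDeriv hgs _) _)

end Integral

end Calculus

/-! ### Convergence of mollifications in `L¹`. -/

section Mollify

open Filter Topology Convolution ContinuousLinearMap

/-- **Scheffé's lemma**. -/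
theorem tendsto_integral_abs_sub_of_integral_eq {α : Type*} [MeasurableSpace α] {μ : Measure α}
    {F : ℕ → α → ℝ} {f : α → ℝ} (hF : ∀ i, Integrable (F i) μ) (hf : Integrable f μ)
    (hF0 : ∀ i x, 0 ≤ F i x) (hf0 : ∀ x, 0 ≤ f x) (heq : ∀ i, ∫ x, F i x ∂μ = ∫ x, f x ∂μ)
    (hlim : ∀ᵐ x ∂μ, Tendsto (fun i => F i x) atTop (𝓝 (f x))) :
    Tendsto (fun i => ∫ x, |F i x - f x| ∂μ) atTop (𝓝 0) := by
  -- Pointwise `|F - f| = 2 (f - F)⁺ + (F - f)`, and the last term integrates to zero. The positive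
  -- part lies between `0` and `f`, so dominated convergence applies to it.
  have h1 : ∀ i, ∫ x, |F i x - f x| ∂μ = 2 * ∫ x, max (f x - F i x) 0 ∂μ := fun i => by
    have h : ∀ x, |F i x - f x| = 2 * max (f x - F i x) 0 + (F i x - f x) := fun x => by
      rcases le_total (f x) (F i x) with h | h
      · rw [abs_of_nonneg (by linarith), max_eq_right (by linarith)]; ring
      · rw [abs_of_nonpos (by linarith), max_eq_left (by linarith)]; ring
    simp only [h]
    have hm : Integrable (fun x => max (f x - F i x) 0) μ := (hf.sub (hF i)).pos_part
    have hs : Integrable (fun x => F i x - f x) μ := (hF i).sub hf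
    rw [integral_add (hm.const_mul 2) hs, integral_const_mul,
      integral_sub (hF i) hf, heq i]
    ring
  simp only [h1]
  have : Tendsto (fun i => ∫ x, max (f x - F i x) 0 ∂μ) atTop (𝓝 (∫ _, (0 : ℝ) ∂μ)) := by
    refine tendsto_integral_of_dominated_convergence f
      (fun i => (hf.sub (hF i)).pos_part.aestronglyMeasurable) hf (fun i => ?_) ?_
    · refine Eventually.of_forall fun x => ?_
      rw [Real.norm_of_nonneg (le_max_right _ _)]
      exact max_le (by linarith [hF0 i x]) (hf0 x)
    · filter_upwards [hlim] with x hx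
      have := ((tendsto_const_nhds (x := f x)).sub hx).max (tendsto_const_nhds (x := (0 : ℝ)))
      simpa using this
  simpa using this.const_mul 2

variable {G : Type*} [NormedAddCommGroup G] [NormedSpace ℝ G] [MeasurableSpace G] [BorelSpace G]
  [FiniteDimensional ℝ G] {μ : Measure G} [μ.IsAddHaarMeasure]

theorem integrable_bump_convolution (φ : ContDiffBump (0 : G)) {g : G → ℝ} (hg : Integrable g μ) :
    Integrable (φ.normed μ ⋆[lsmul ℝ ℝ, μ] g) μ :=
  Integrable.integrable_convolution _ φ.integrable_normed hg

theorem integral_bump_convolution (φ : ContDiffBump (0 : G)) {g : G → ℝ} (hg : Integrable g μ) :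
    ∫ x, (φ.normed μ ⋆[lsmul ℝ ℝ, μ] g) x ∂μ = ∫ x, g x ∂μ := by
  rw [integral_convolution _ φ.integrable_normed hg, φ.integral_normed]
  simp

theorem bump_convolution_integrand (φ : ContDiffBump (0 : G)) {g : G → ℝ} (hg : Integrable g μ)
    (x : G) : Integrable (fun t => φ.normed μ t • g (x - t)) μ :=
  (φ.hasCompactSupport_normed.convolutionExists_left (lsmul ℝ ℝ) φ.continuous_normed
    hg.locallyIntegrable x)

/-- Mollifications of an integrable function converge in `L¹`. -/
theorem tendsto_integral_abs_bump_convolution_sub {φ : ℕ → ContDiffBump (0 : G)} {K : ℝ}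
    (hφ : Tendsto (fun i => (φ i).rOut) atTop (𝓝 0))
    (hK : ∀ i, (φ i).rOut ≤ K * (φ i).rIn) {g : G → ℝ} (hg : Integrable g μ) :
    Tendsto (fun i => ∫ x, |((φ i).normed μ ⋆[lsmul ℝ ℝ, μ] g) x - g x| ∂μ) atTop (𝓝 0) := by
  -- For a nonnegative function, mollification preserves sign and integral and converges almost
  -- everywhere by Lebesgue differentiation, so Scheffé's lemma applies. The general case splits
  -- into positive and negative parts.
  have key : ∀ h : G → ℝ, Integrable h μ → (∀ x, 0 ≤ h x) →
      Tendsto (fun i => ∫ x, |((φ i).normed μ ⋆[lsmul ℝ ℝ, μ] h) x - h x| ∂μ) atTop (𝓝 0) :=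
    fun h hh h0 => tendsto_integral_abs_sub_of_integral_eq
      (fun i => integrable_bump_convolution (φ i) hh) hh
      (fun i x => integral_nonneg fun t => by
        simpa using mul_nonneg ((φ i).nonneg_normed t) (h0 (x - t))) h0
      (fun i => integral_bump_convolution (φ i) hh)
      (ContDiffBump.ae_convolution_tendsto_right_of_locallyIntegrable hφ
        (Eventually.of_forall hK) hh.locallyIntegrable)
  have hp := key _ hg.pos_part fun x => le_max_right _ _
  have hn := key _ hg.neg_part fun x => le_max_right _ _
  have hpn := hp.add hn
  rw [add_zero] at hpn
  refine squeeze_zero (fun i => integral_nonneg fun x => abs_nonneg _) (fun i => ?_) hpn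
  have ip : Integrable (fun x => |((φ i).normed μ ⋆[lsmul ℝ ℝ, μ] fun y => max (g y) 0) x
      - max (g x) 0|) μ :=
    ((integrable_bump_convolution (φ i) hg.pos_part).sub hg.pos_part).abs
  have im : Integrable (fun x => |((φ i).normed μ ⋆[lsmul ℝ ℝ, μ] fun y => max (-g y) 0) x
      - max (-g x) 0|) μ :=
    ((integrable_bump_convolution (φ i) hg.neg_part).sub hg.neg_part).abs
  rw [← integral_add ip im]
  refine integral_mono ((integrable_bump_convolution (φ i) hg).sub hg).abs (ip.add im)
    fun x => ?_
  have hx : ((φ i).normed μ ⋆[lsmul ℝ ℝ, μ] g) x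
      = ((φ i).normed μ ⋆[lsmul ℝ ℝ, μ] fun y => max (g y) 0) x
        - ((φ i).normed μ ⋆[lsmul ℝ ℝ, μ] fun y => max (-g y) 0) x := by
    simp only [convolution_def]
    rw [← integral_sub]
    · refine integral_congr_ae (Eventually.of_forall fun t => ?_)
      simp only [lsmul_apply, smul_eq_mul, ← mul_sub]
      congr 1
      have := max_zero_sub_max_neg_zero_eq_self (g (x - t))
      exact this.symm
    · exact bump_convolution_integrand (φ i) hg.pos_part x
    · exact bump_convolution_integrand (φ i) hg.neg_part x
  have hgx : g x = max (g x) 0 - max (-g x) 0 := (max_zero_sub_max_neg_zero_eq_self (g x)).symm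
  beta_reduce
  rw [hx]
  conv_lhs => rw [hgx]
  refine le_trans (le_of_eq ?_) (abs_sub _ _)
  congr 1
  ring

end Mollify

/-! ### Mollified distributional solutions and Kato's inequality for convex functions. -/

section Kato

open Filter Topology Convolution ContinuousLinearMap

theorem dirDeriv_comp_const_sub {G : Type*} [NormedAddCommGroup G] [NormedSpace ℝ G] (v : G)
    {f : G → ℝ} (hf : ContDiff ℝ ∞ f) (p : G) :
    dirDeriv v (fun q => f (p - q)) = fun q => -dirDeriv v f (p - q) := by
  ext q
  have h1 := (hf.differentiable (by simp) (p - q)).hasFDerivAt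
  have h2 : HasFDerivAt (fun q : G => p - q) (-ContinuousLinearMap.id ℝ G) q :=
    (hasFDerivAt_id q).const_sub p
  have := (h1.comp q h2).fderiv
  simp only [dirDeriv]
  rw [show (fun q => f (p - q)) = f ∘ fun q => p - q from rfl, this]
  simp

/-- The reflection `q ↦ p - q` changes the sign of first derivatives only. With a mollifier for `f`,
this identifies the weak formulation tested against the reflected mollifier with the adjoint
operator applied to the convolution at `p`. -/
theorem heatOp_comp_const_sub {G : Type*} [NormedAddCommGroup G] [NormedSpace ℝ G] {ι : Type*}
    [Fintype ι] (τ : G) (e : ι → G) {f : G → ℝ} (hf : ContDiff ℝ ∞ f) (p q : G) :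
    heatOp τ e (fun q => f (p - q)) q = heatOp (-τ) e f (p - q) := by
  have h : ∀ i, dirDeriv (e i) (dirDeriv (e i) fun q => f (p - q)) q
      = dirDeriv (e i) (dirDeriv (e i) f) (p - q) := fun i => by
    have hn : ContDiff ℝ ∞ fun q => -dirDeriv (e i) f q := (contDiff_dirDeriv hf _).neg
    rw [dirDeriv_comp_const_sub _ hf,
      dirDeriv_comp_const_sub (f := fun q => -dirDeriv (e i) f q) _ hn]
    change -fderiv ℝ (fun q => -dirDeriv (e i) f q) (p - q) (e i)
      = fderiv ℝ (dirDeriv (e i) f) (p - q) (e i)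
    simp
  simp only [heatOp, h, dirDeriv_comp_const_sub τ hf, dirDeriv_neg_dir]

variable {G : Type*} [NormedAddCommGroup G] [NormedSpace ℝ G] [MeasurableSpace G] [BorelSpace G]
  [FiniteDimensional ℝ G] {ι : Type*} [Fintype ι]

/-- `U` satisfies `-D_τ U + ∑ᵢ D_{eᵢ}² U = H` in `Ω` in the sense of distributions. -/
def IsDistribSolution (μ : Measure G) (τ : G) (e : ι → G) (Ω : Set G) (U H : G → ℝ) : Prop :=
  ∀ ψ : G → ℝ, ContDiff ℝ ∞ ψ → HasCompactSupport ψ → tsupport ψ ⊆ Ω →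
    ∫ p, U p * heatOp τ e ψ p ∂μ = ∫ p, H p * ψ p ∂μ

variable {μ : Measure G} [μ.IsAddHaarMeasure] {τ : G} {e : ι → G} {Ω : Set G}

theorem dirDeriv_convolution {ρ U : G → ℝ} (hρ : ContDiff ℝ ∞ ρ) (hρs : HasCompactSupport ρ)
    (hU : LocallyIntegrable U μ) (v : G) :
    dirDeriv v (ρ ⋆[lsmul ℝ ℝ, μ] U) = dirDeriv v ρ ⋆[lsmul ℝ ℝ, μ] U := by
  ext p
  have h1 : ContDiff ℝ 1 ρ := hρ.of_le (by simp)
  simp only [dirDeriv]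
  rw [(hρs.hasFDerivAt_convolution_left (lsmul ℝ ℝ) h1 hU p).fderiv, convolution_def,
    ContinuousLinearMap.integral_apply]
  · rfl
  · exact HasCompactSupport.convolutionExists_left _ (hρs.fderiv ℝ)
      (h1.continuous_fderiv (by simp)) hU p

theorem heatOp_convolution {ρ U : G → ℝ} (hρ : ContDiff ℝ ∞ ρ) (hρs : HasCompactSupport ρ)
    (hU : LocallyIntegrable U μ) (σ : G) (p : G) :
    heatOp σ e (ρ ⋆[lsmul ℝ ℝ, μ] U) p = (heatOp σ e ρ ⋆[lsmul ℝ ℝ, μ] U) p := by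
  have h : ∀ i, dirDeriv (e i) (dirDeriv (e i) (ρ ⋆[lsmul ℝ ℝ, μ] U))
      = dirDeriv (e i) (dirDeriv (e i) ρ) ⋆[lsmul ℝ ℝ, μ] U := fun i => by
    rw [dirDeriv_convolution hρ hρs hU, dirDeriv_convolution (contDiff_dirDeriv hρ _)
      (hasCompactSupport_dirDeriv hρs _) hU]
  have ex : ∀ f : G → ℝ, ContDiff ℝ ∞ f → HasCompactSupport f →
      Integrable (fun t => f t * U (p - t)) μ := fun f hf hfs =>
    HasCompactSupport.convolutionExists_left (lsmul ℝ ℝ) hfs hf.continuous hU p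
  simp only [heatOp, h]
  simp only [dirDeriv_convolution hρ hρs hU, convolution_def, lsmul_apply, smul_eq_mul, heatOp,
    add_mul, Finset.sum_mul]
  rw [integral_add, integral_finsetSum]
  · exact fun i _ => ex _ (contDiff_dirDeriv (contDiff_dirDeriv hρ _) _)
      (hasCompactSupport_dirDeriv (hasCompactSupport_dirDeriv hρs _) _)
  · exact ex _ (contDiff_dirDeriv hρ _) (hasCompactSupport_dirDeriv hρs _)
  · exact integrable_finsetSum _ fun i _ => ex _ (contDiff_dirDeriv (contDiff_dirDeriv hρ _) _)
      (hasCompactSupport_dirDeriv (hasCompactSupport_dirDeriv hρs _) _)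

/-- A mollified distributional solution is a classical solution. -/
theorem IsDistribSolution.heatOp_bump_convolution {U H : G → ℝ}
    (h : IsDistribSolution μ τ e Ω U H) (hU : LocallyIntegrable U μ) (φ : ContDiffBump (0 : G))
    {p : G} (hp : Metric.closedBall p φ.rOut ⊆ Ω) :
    heatOp (-τ) e (φ.normed μ ⋆[lsmul ℝ ℝ, μ] U) p = (φ.normed μ ⋆[lsmul ℝ ℝ, μ] H) p := by
  have hρ : ContDiff ℝ ∞ (φ.normed μ) := φ.contDiff_normed
  have hsub : Function.support (fun q => φ.normed μ (p - q)) ⊆ Metric.closedBall p φ.rOut := by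
    intro q hq
    have : p - q ∈ Function.support (φ.normed μ) := hq
    rw [φ.support_normed_eq, mem_ball_zero_iff, ← dist_eq_norm] at this
    rw [Metric.mem_closedBall, dist_comm]
    exact this.le
  rw [heatOp_convolution hρ φ.hasCompactSupport_normed hU, convolution_eq_swap,
    convolution_eq_swap]
  have := h (fun q => φ.normed μ (p - q)) (hρ.comp (contDiff_const.sub contDiff_id))
    (HasCompactSupport.of_support_subset_isCompact (isCompact_closedBall p φ.rOut) hsub)
    ((closure_minimal hsub Metric.isClosed_closedBall).trans hp)
  simp only [heatOp_comp_const_sub τ e hρ] at this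
  simpa [mul_comm] using this

/-- The bounded ratio of outer to inner radius is what Lebesgue differentiation needs for almost
everywhere convergence of the mollifications. -/
theorem exists_bump_sequence (G : Type*) [NormedAddCommGroup G] :
    ∃ φ : ℕ → ContDiffBump (0 : G), Tendsto (fun i => (φ i).rOut) atTop (𝓝 0) ∧
      ∀ i, (φ i).rOut ≤ 2 * (φ i).rIn := by
  refine ⟨fun i => ⟨1 / ((i : ℝ) + 1), 2 * (1 / ((i : ℝ) + 1)), by positivity, ?_⟩, ?_, ?_⟩
  · have : 0 < 1 / ((i : ℝ) + 1) := by positivity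
    linarith
  · simpa using (tendsto_one_div_add_atTop_nhds_zero_nat (𝕜 := ℝ)).const_mul 2
  · exact fun i => le_rfl

/-- Kato's inequality for a smooth convex Lipschitz function. -/
theorem IsDistribSolution.integral_convex_le {U H : G → ℝ}
    (h : IsDistribSolution μ τ e Ω U H) (hΩ : IsOpen Ω) (hU : Integrable U μ)
    (hH : Integrable H μ) {j : ℝ → ℝ} (hj : ContDiff ℝ ∞ j) (hj1 : ∀ r, |deriv j r| ≤ 1)
    (hj2 : ∀ r, 0 ≤ deriv (deriv j) r) {φ : G → ℝ} (hφ : ContDiff ℝ ∞ φ)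
    (hφs : HasCompactSupport φ) (hφΩ : tsupport φ ⊆ Ω) (hφ0 : ∀ p, 0 ≤ φ p) :
    ∫ p, deriv j (U p) * H p * φ p ∂μ ≤ ∫ p, j (U p) * heatOp τ e φ p ∂μ := by
  obtain ⟨ρ, hρ, hρK⟩ := exists_bump_sequence G
  obtain ⟨ε, hε, hεΩ⟩ := hφs.isCompact.exists_cthickening_subset_open hΩ hφΩ
  set u : ℕ → G → ℝ := fun i => (ρ i).normed μ ⋆[lsmul ℝ ℝ, μ] U with hu
  set f : ℕ → G → ℝ := fun i => (ρ i).normed μ ⋆[lsmul ℝ ℝ, μ] H with hf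
  have hjlip : ∀ a b, |j a - j b| ≤ |a - b| := fun a b => by
    have := (lipschitzWith_of_nnnorm_deriv_le (C := 1) (hj.differentiable (by simp))
      (fun x => hj1 x)).dist_le_mul a b
    simpa [Real.dist_eq] using this
  have hj'c : Continuous (deriv j) := (contDiff_deriv hj).continuous
  have husm : ∀ i, ContDiff ℝ ∞ (u i) := fun i =>
    (ρ i).hasCompactSupport_normed.contDiff_convolution_left _ (ρ i).contDiff_normed
      hU.locallyIntegrable
  have hfsm : ∀ i, ContDiff ℝ ∞ (f i) := fun i =>
    (ρ i).hasCompactSupport_normed.contDiff_convolution_left _ (ρ i).contDiff_normed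
      hH.locallyIntegrable
  have hui : ∀ i, Integrable (u i) μ := fun i => integrable_bump_convolution (ρ i) hU
  have hfi : ∀ i, Integrable (f i) μ := fun i => integrable_bump_convolution (ρ i) hH
  have hPc := (contDiff_heatOp τ e hφ).continuous
  have hPs := hasCompactSupport_heatOp τ e hφs
  obtain ⟨A, hA⟩ := hPs.exists_bound_of_continuous hPc
  obtain ⟨B, hB⟩ := hφs.exists_bound_of_continuous hφ.continuous
  simp only [Real.norm_eq_abs] at hA hB
  have hB0 : 0 ≤ B := (abs_nonneg _).trans (hB 0)
  -- the inequality for the mollified functions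
  have hineq : ∀ᶠ i in atTop, ∫ p, deriv j (u i p) * f i p * φ p ∂μ
      ≤ ∫ p, j (u i p) * heatOp τ e φ p ∂μ := by
    filter_upwards [hρ.eventually (eventually_le_nhds hε)] with i hi
    rw [integral_mul_heatOp (f := fun p => j (u i p)) τ e (hj.comp (husm i)) hφ hφs]
    refine integral_mono
      (integrable_mul_of_hasCompactSupport
        ((hj'c.comp (husm i).continuous).mul (hfsm i).continuous) hφ.continuous hφs)
      (integrable_mul_of_hasCompactSupport
        (contDiff_heatOp (-τ) e (hj.comp (husm i))).continuous hφ.continuous hφs) fun p => ?_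
    by_cases hp : p ∈ tsupport φ
    · refine mul_le_mul_of_nonneg_right ?_ (hφ0 p)
      have hb : Metric.closedBall p (ρ i).rOut ⊆ Ω := by
        refine (Metric.closedBall_subset_closedBall hi).trans (Subset.trans ?_ hεΩ)
        exact Metric.closedBall_subset_cthickening hp ε
      have hs := h.heatOp_bump_convolution hU.locallyIntegrable (ρ i) hb
      have hc := heatOp_comp (-τ) e hj (husm i) p
      rw [hc, show heatOp (-τ) e (u i) p = f i p from hs]
      -- The term dropped is `j''(u) ∑ᵢ (D_{eᵢ} u)²`, nonnegative by convexity of `j`.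
      exact le_add_of_nonneg_right
        (mul_nonneg (hj2 _) (Finset.sum_nonneg fun _ _ => sq_nonneg _))
    · simp [image_eq_zero_of_notMem_tsupport hp]
  -- the limit on the right
  have hjU : Integrable (fun p => j (U p) * heatOp τ e φ p) μ := by
    -- The Lipschitz bound controls `j (U p) - j 0` by `|U p|`; the constant `j 0` is integrable
    -- only against the compactly supported factor.
    have h1 : Integrable (fun p => (j (U p) - j 0) * heatOp τ e φ p) μ := by
      refine (hU.norm.mul_const A).mono' (((hj.continuous.comp_aestronglyMeasurable
        hU.aestronglyMeasurable).sub aestronglyMeasurable_const).mul hPc.aestronglyMeasurable)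
        (Eventually.of_forall fun p => ?_)
      rw [norm_mul]
      have := hjlip (U p) 0
      rw [sub_zero] at this
      exact mul_le_mul this (hA p) (abs_nonneg _) (abs_nonneg _)
    have h2 : Integrable (fun p => j 0 * heatOp τ e φ p) μ :=
      (hPc.integrable_of_hasCompactSupport hPs).const_mul _
    refine (h1.add h2).congr (Eventually.of_forall fun p => ?_)
    simp only [Pi.add_apply]; ring
  have hR : Tendsto (fun i => ∫ p, j (u i p) * heatOp τ e φ p ∂μ) atTop
      (𝓝 (∫ p, j (U p) * heatOp τ e φ p ∂μ)) := by
    rw [tendsto_iff_norm_sub_tendsto_zero]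
    have hL := (tendsto_integral_abs_bump_convolution_sub hρ hρK hU).mul_const A
    rw [zero_mul] at hL
    refine squeeze_zero (fun _ => norm_nonneg _) (fun i => ?_) hL
    have hi : Integrable (fun p => j (u i p) * heatOp τ e φ p) μ :=
      integrable_mul_of_hasCompactSupport (hj.continuous.comp (husm i).continuous) hPc hPs
    rw [← integral_sub hi hjU, ← integral_mul_const]
    refine norm_integral_le_of_norm_le (((hui i).sub hU).abs.mul_const A)
      (Eventually.of_forall fun p => ?_)
    rw [← sub_mul, norm_mul]
    exact mul_le_mul (hjlip _ _) (hA p) (abs_nonneg _) (abs_nonneg _)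
  -- the limit on the left
  have hbd : ∀ v : G → ℝ, ∀ p, |deriv j (v p) * H p * φ p| ≤ |H p| * B := fun v p => by
    rw [abs_mul, abs_mul]
    refine mul_le_mul ?_ (hB p) (abs_nonneg _) (abs_nonneg _)
    exact mul_le_of_le_one_left (abs_nonneg _) (hj1 _)
  have hmeas : ∀ i, AEStronglyMeasurable (fun p => deriv j (u i p) * H p * φ p) μ := fun i =>
    ((hj'c.comp (husm i).continuous).aestronglyMeasurable.mul hH.aestronglyMeasurable).mul
      hφ.continuous.aestronglyMeasurable
  have hint : ∀ i, Integrable (fun p => deriv j (u i p) * H p * φ p) μ := fun i =>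
    (hH.abs.mul_const B).mono' (hmeas i) (Eventually.of_forall (hbd (u i)))
  -- The mollified right-hand side is split as `f i = H + (f i - H)`. The first part converges by
  -- domination by `|H| B`, the second is bounded by the `L¹` distance of `f i` to `H`.
  have hL1 : Tendsto (fun i => ∫ p, deriv j (u i p) * H p * φ p ∂μ) atTop
      (𝓝 (∫ p, deriv j (U p) * H p * φ p ∂μ)) := by
    refine tendsto_integral_of_dominated_convergence (fun p => |H p| * B) hmeas
      (hH.abs.mul_const B) (fun i => Eventually.of_forall (hbd (u i))) ?_
    filter_upwards [ContDiffBump.ae_convolution_tendsto_right_of_locallyIntegrable hρ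
      (Eventually.of_forall hρK) hU.locallyIntegrable] with p hp
    exact (((hj'c.tendsto _).comp hp).mul_const _).mul_const _
  have hL2 : Tendsto (fun i => ∫ p, deriv j (u i p) * (f i p - H p) * φ p ∂μ) atTop (𝓝 0) := by
    rw [tendsto_zero_iff_norm_tendsto_zero]
    have hL := (tendsto_integral_abs_bump_convolution_sub hρ hρK hH).mul_const B
    rw [zero_mul] at hL
    refine squeeze_zero (fun _ => norm_nonneg _) (fun i => ?_) hL
    rw [← integral_mul_const]
    refine norm_integral_le_of_norm_le (((hfi i).sub hH).abs.mul_const B)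
      (Eventually.of_forall fun p => ?_)
    rw [norm_mul, norm_mul]
    refine mul_le_mul ?_ (hB p) (abs_nonneg _) (abs_nonneg _)
    exact mul_le_of_le_one_left (abs_nonneg _) (hj1 _)
  have hL : Tendsto (fun i => ∫ p, deriv j (u i p) * f i p * φ p ∂μ) atTop
      (𝓝 (∫ p, deriv j (U p) * H p * φ p ∂μ)) := by
    have := hL1.add hL2
    rw [add_zero] at this
    refine this.congr fun i => ?_
    have hi : Integrable (fun p => deriv j (u i p) * f i p * φ p) μ :=
      integrable_mul_of_hasCompactSupport
        ((hj'c.comp (husm i).continuous).mul (hfsm i).continuous) hφ.continuous hφs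
    have hd : ∀ p, deriv j (u i p) * (f i p - H p) * φ p
        = deriv j (u i p) * f i p * φ p - deriv j (u i p) * H p * φ p := fun p => by ring
    simp only [hd]
    rw [integral_sub hi (hint i)]
    ring
  exact le_of_tendsto_of_tendsto hL hR hineq

end Kato

/-! ### Kato's inequality for the absolute value. -/

section KatoAbs

open Filter Topology

/-- A smooth convex approximation of the absolute value. -/
def smoothAbs (δ r : ℝ) : ℝ := √(r ^ 2 + δ ^ 2)

theorem smoothAbs_arg_pos {δ : ℝ} (hδ : 0 < δ) (r : ℝ) : 0 < r ^ 2 + δ ^ 2 := by positivity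

theorem contDiff_smoothAbs {δ : ℝ} (hδ : 0 < δ) : ContDiff ℝ ∞ (smoothAbs δ) :=
  ((contDiff_id.pow 2).add contDiff_const).sqrt fun r => (smoothAbs_arg_pos hδ r).ne'

theorem hasDerivAt_smoothAbs {δ : ℝ} (hδ : 0 < δ) (r : ℝ) :
    HasDerivAt (smoothAbs δ) (r / √(r ^ 2 + δ ^ 2)) r := by
  have h : HasDerivAt (fun r : ℝ => r ^ 2 + δ ^ 2) (2 * r) r := by
    simpa using ((hasDerivAt_id r).pow 2).add_const (δ ^ 2)
  have := h.sqrt (smoothAbs_arg_pos hδ r).ne'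
  rwa [mul_div_mul_left _ _ two_ne_zero] at this

theorem deriv_smoothAbs {δ : ℝ} (hδ : 0 < δ) :
    deriv (smoothAbs δ) = fun r => r / √(r ^ 2 + δ ^ 2) :=
  funext fun r => (hasDerivAt_smoothAbs hδ r).deriv

theorem abs_le_sqrt_sq_add (δ r : ℝ) : |r| ≤ √(r ^ 2 + δ ^ 2) :=
  Real.abs_le_sqrt (by nlinarith [sq_nonneg δ])

theorem abs_deriv_smoothAbs_le {δ : ℝ} (hδ : 0 < δ) (r : ℝ) : |deriv (smoothAbs δ) r| ≤ 1 := by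
  have hs := Real.sqrt_pos.2 (smoothAbs_arg_pos hδ r)
  rw [deriv_smoothAbs hδ, abs_div, abs_of_pos hs, div_le_one hs]
  exact abs_le_sqrt_sq_add δ r

theorem deriv_deriv_smoothAbs_nonneg {δ : ℝ} (hδ : 0 < δ) (r : ℝ) :
    0 ≤ deriv (deriv (smoothAbs δ)) r := by
  have hs := Real.sqrt_pos.2 (smoothAbs_arg_pos hδ r)
  have := ((hasDerivAt_id r).div (hasDerivAt_smoothAbs hδ r) hs.ne').deriv
  rw [deriv_smoothAbs hδ]
  change deriv (fun r => id r / smoothAbs δ r) r = _ at this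
  change 0 ≤ deriv (fun r => id r / smoothAbs δ r) r
  rw [this]
  refine div_nonneg ?_ (sq_nonneg _)
  simp only [smoothAbs, id, one_mul]
  rw [sub_nonneg, ← mul_div_assoc, div_le_iff₀ hs, Real.mul_self_sqrt (smoothAbs_arg_pos hδ r).le]
  nlinarith [sq_nonneg δ]

theorem smoothAbs_le {δ : ℝ} (hδ : 0 < δ) (r : ℝ) : smoothAbs δ r ≤ |r| + δ := by
  refine Real.sqrt_le_iff.2 ⟨by positivity, ?_⟩
  nlinarith [sq_abs r, abs_nonneg r]

theorem tendsto_smoothAbs (r : ℝ) :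
    Tendsto (fun i : ℕ => smoothAbs (1 / ((i : ℝ) + 1)) r) atTop (𝓝 |r|) := by
  have h := tendsto_one_div_add_atTop_nhds_zero_nat (𝕜 := ℝ)
  have := ((h.pow 2).const_add (r ^ 2)).sqrt
  simpa [smoothAbs, Real.sqrt_sq_eq_abs] using this

variable {G : Type*} [NormedAddCommGroup G] [NormedSpace ℝ G] [MeasurableSpace G] [BorelSpace G]
  [FiniteDimensional ℝ G] {ι : Type*} [Fintype ι]
  {μ : Measure G} [μ.IsAddHaarMeasure] {τ : G} {e : ι → G} {Ω : Set G}

/-- The derivative of `smoothAbs δ` at `U` has the sign of `U`, so its product with `H` is `U H /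
√(U² + δ²) ≥ 0`. This makes the left side of the convex inequality nonnegative for every `δ`, and `δ
→ 0` is justified by the bound `|U| + 1`. -/
theorem IsDistribSolution.integral_abs_nonneg_of_integrable {U H : G → ℝ}
    (h : IsDistribSolution μ τ e Ω U H) (hΩ : IsOpen Ω) (hU : Integrable U μ)
    (hH : Integrable H μ) (hUH : ∀ᵐ p ∂μ, 0 ≤ U p * H p) {φ : G → ℝ} (hφ : ContDiff ℝ ∞ φ)
    (hφs : HasCompactSupport φ) (hφΩ : tsupport φ ⊆ Ω) (hφ0 : ∀ p, 0 ≤ φ p) :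
    0 ≤ ∫ p, |U p| * heatOp τ e φ p ∂μ := by
  have hPc := (contDiff_heatOp τ e hφ).continuous
  have hPs := hasCompactSupport_heatOp τ e hφs
  have hi : ∀ i : ℕ, (0 : ℝ) < 1 / ((i : ℝ) + 1) := fun i => by positivity
  have key : ∀ i : ℕ, 0 ≤ ∫ p, smoothAbs (1 / ((i : ℝ) + 1)) (U p) * heatOp τ e φ p ∂μ := by
    intro i
    refine le_trans ?_ (h.integral_convex_le hΩ hU hH (contDiff_smoothAbs (hi i))
      (abs_deriv_smoothAbs_le (hi i)) (deriv_deriv_smoothAbs_nonneg (hi i)) hφ hφs hφΩ hφ0)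
    refine integral_nonneg_of_ae ?_
    filter_upwards [hUH] with p hp
    rw [deriv_smoothAbs (hi i)]
    refine mul_nonneg ?_ (hφ0 p)
    rw [div_mul_eq_mul_div]
    exact div_nonneg hp (Real.sqrt_nonneg _)
  have hlim : Tendsto (fun i : ℕ => ∫ p, smoothAbs (1 / ((i : ℝ) + 1)) (U p) * heatOp τ e φ p ∂μ)
      atTop (𝓝 (∫ p, |U p| * heatOp τ e φ p ∂μ)) := by
    refine tendsto_integral_of_dominated_convergence (fun p => (|U p| + 1) * |heatOp τ e φ p|)
      (fun i => ((contDiff_smoothAbs (hi i)).continuous.comp_aestronglyMeasurable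
        hU.aestronglyMeasurable).mul hPc.aestronglyMeasurable) ?_
      (fun i => Eventually.of_forall fun p => ?_)
      (Eventually.of_forall fun p => (tendsto_smoothAbs (U p)).mul_const _)
    · have h1 : Integrable (fun p => heatOp τ e φ p * |U p|) μ :=
        hU.abs.locallyIntegrable.integrable_smul_left_of_hasCompactSupport hPc hPs
      refine (h1.abs.add (hPc.integrable_of_hasCompactSupport hPs).abs).congr
        (Eventually.of_forall fun p => ?_)
      simp only [Pi.add_apply, abs_mul, abs_abs]
      ring
    · rw [norm_mul, Real.norm_eq_abs, Real.norm_eq_abs]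
      refine mul_le_mul_of_nonneg_right ?_ (abs_nonneg _)
      have h0 : 0 ≤ smoothAbs (1 / ((i : ℝ) + 1)) (U p) := Real.sqrt_nonneg _
      rw [abs_of_nonneg h0]
      refine (smoothAbs_le (hi i) _).trans (add_le_add_right ?_ _)
      rw [div_le_one (by positivity)]
      linarith [(Nat.cast_nonneg i : (0 : ℝ) ≤ i)]
  exact ge_of_tendsto' hlim key

/-- **Kato's inequality**: if `-D_τ U + ∑ᵢ D_{eᵢ}² U = H` and `U H ≥ 0`, then
`-D_τ |U| + ∑ᵢ D_{eᵢ}² |U| ≥ 0` in the sense of distributions. -/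
theorem IsDistribSolution.integral_abs_nonneg {U H : G → ℝ}
    (h : IsDistribSolution μ τ e Ω U H) (hΩ : IsOpen Ω) (hU : LocallyIntegrable U μ)
    (hH : LocallyIntegrable H μ) (hUH : ∀ᵐ p ∂μ, 0 ≤ U p * H p) {φ : G → ℝ}
    (hφ : ContDiff ℝ ∞ φ) (hφs : HasCompactSupport φ) (hφΩ : tsupport φ ⊆ Ω)
    (hφ0 : ∀ p, 0 ≤ φ p) : 0 ≤ ∫ p, |U p| * heatOp τ e φ p ∂μ := by
  obtain ⟨R, hR⟩ := hφs.isCompact.isBounded.subset_ball (0 : G)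
  -- Truncating `U` and `H` to a ball containing the support of `φ` makes them integrable and leaves
  -- the equation unchanged on `Ω ∩ B`.
  set B := Metric.ball (0 : G) R
  have hBi : ∀ f : G → ℝ, LocallyIntegrable f μ → Integrable (B.indicator f) μ := fun f hf =>
    ((hf.integrableOn_isCompact (isCompact_closedBall 0 R)).mono_set
      Metric.ball_subset_closedBall).integrable_indicator measurableSet_ball
  have hloc : ∀ ψ : G → ℝ, tsupport ψ ⊆ B → ∀ f g : G → ℝ, Function.support g ⊆ tsupport ψ →
      ∀ p, B.indicator f p * g p = f p * g p := fun ψ hψ f g hg p => by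
    by_cases hp : p ∈ B
    · rw [indicator_of_mem hp]
    · have : g p = 0 := by
        by_contra h0
        exact hp (hψ (hg h0))
      rw [this, mul_zero, mul_zero]
  have h' : IsDistribSolution μ τ e (Ω ∩ B) (B.indicator U) (B.indicator H) := by
    intro ψ hψ hψs hψΩ
    have hψB := hψΩ.trans inter_subset_right
    simp only [hloc ψ hψB U _ (support_heatOp_subset τ e ψ), hloc ψ hψB H ψ (subset_tsupport ψ)]
    exact h ψ hψ hψs (hψΩ.trans inter_subset_left)
  have key := h'.integral_abs_nonneg_of_integrable (hΩ.inter Metric.isOpen_ball) (hBi U hU)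
    (hBi H hH) (by
      filter_upwards [hUH] with p hp
      by_cases hpB : p ∈ B
      · rwa [indicator_of_mem hpB, indicator_of_mem hpB]
      · simp [indicator_of_notMem hpB]) hφ hφs (subset_inter hφΩ hR) hφ0
  have habs : ∀ p, |B.indicator U p| = B.indicator (fun p => |U p|) p := fun p => by
    by_cases hpB : p ∈ B
    · rw [indicator_of_mem hpB, indicator_of_mem hpB]
    · simp [indicator_of_notMem hpB]
  simpa only [habs, hloc φ hR _ _ (support_heatOp_subset τ e φ)] using key

end KatoAbs

/-! ### From weak solutions to a distributional equation on `{t < T}`. -/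

section WeakForm

variable {n : ℕ}

/-- The unit vector of the time axis. -/
def timeVec (n : ℕ) : SpaceTime n := (0, 1)

/-- The unit vectors of the space axes. -/
def spaceVec (n : ℕ) (i : Fin n) : SpaceTime n := (EuclideanSpace.single i 1, 0)

theorem timeDeriv_eq_dirDeriv {ψ : SpaceTime n → ℝ} (hψ : ContDiff ℝ ∞ ψ) (p : SpaceTime n) :
    timeDeriv ψ p = dirDeriv (timeVec n) ψ p := by
  have h1 := (hψ.differentiable (by simp) p).hasFDerivAt
  have h2 : HasDerivAt (fun s : ℝ => ((p.1, s) : SpaceTime n)) (0, 1) p.2 :=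
    (hasDerivAt_const p.2 p.1).prodMk (hasDerivAt_id p.2)
  exact (HasFDerivAt.comp_hasDerivAt (f := fun s : ℝ => ((p.1, s) : SpaceTime n)) p.2 h1 h2).deriv

theorem fderiv_slice {ψ : SpaceTime n → ℝ} (hψ : ContDiff ℝ ∞ ψ) (t : ℝ)
    (y v : EuclideanSpace ℝ (Fin n)) :
    fderiv ℝ (fun y => ψ (y, t)) y v = dirDeriv (v, 0) ψ (y, t) := by
  have h1 := (hψ.differentiable (by simp) (y, t)).hasFDerivAt
  have := (HasFDerivAt.comp (f := fun y => (y, t)) y h1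
    (hasFDerivAt_prodMk_left (𝕜 := ℝ) y t)).fderiv
  change fderiv ℝ (ψ ∘ fun y => (y, t)) y v = _
  rw [this]
  simp [dirDeriv]

theorem spaceLaplacian_eq_sum {ψ : SpaceTime n → ℝ} (hψ : ContDiff ℝ ∞ ψ) (p : SpaceTime n) :
    spaceLaplacian ψ p = ∑ i, dirDeriv (spaceVec n i) (dirDeriv (spaceVec n i) ψ) p := by
  have hs : ContDiff ℝ ∞ (fun y : EuclideanSpace ℝ (Fin n) => ψ (y, p.2)) :=
    hψ.comp (contDiff_id.prodMk contDiff_const)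
  have hs' : ContDiff ℝ ∞ (fderiv ℝ (fun y : EuclideanSpace ℝ (Fin n) => ψ (y, p.2))) :=
    hs.fderiv_right (by simp)
  rw [spaceLaplacian, InnerProductSpace.laplacian_eq_iteratedFDeriv_orthonormalBasis _
    (EuclideanSpace.basisFun (Fin n) ℝ)]
  refine Finset.sum_congr rfl fun i _ => ?_
  rw [iteratedFDeriv_two_apply]
  have h1 : fderiv ℝ (fderiv ℝ fun y : EuclideanSpace ℝ (Fin n) => ψ (y, p.2)) p.1
      (EuclideanSpace.single i 1) (EuclideanSpace.single i 1)
      = fderiv ℝ (fun y : EuclideanSpace ℝ (Fin n) => fderiv ℝ (fun y => ψ (y, p.2)) y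
        (EuclideanSpace.single i 1)) p.1 (EuclideanSpace.single i 1) := by
    rw [fderiv_clm_apply (hs'.differentiable (by simp) _) (differentiableAt_const _)]
    simp
  simp only [EuclideanSpace.basisFun_apply, Matrix.cons_val_zero, Matrix.cons_val_one]
  rw [h1]
  simp only [fderiv_slice hψ]
  exact fderiv_slice (contDiff_dirDeriv hψ _) p.2 p.1 _

theorem heatOp_eq {ψ : SpaceTime n → ℝ} (hψ : ContDiff ℝ ∞ ψ) (p : SpaceTime n) :
    heatOp (-timeVec n) (spaceVec n) ψ p = -timeDeriv ψ p + spaceLaplacian ψ p := by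
  rw [timeDeriv_eq_dirDeriv hψ, spaceLaplacian_eq_sum hψ, heatOp, dirDeriv_neg_dir]

theorem isOpen_Q (n : ℕ) (T : ℝ) : IsOpen (Q n T) := isOpen_univ.prod isOpen_Ioo

theorem Q_subset_closedQ (n : ℕ) (T : ℝ) : Q n T ⊆ closedQ n T :=
  prod_mono subset_rfl Ioo_subset_Icc_self

instance : (volume : Measure (SpaceTime n)).IsAddHaarMeasure :=
  inferInstanceAs ((volume : Measure (EuclideanSpace ℝ (Fin n))).prod
    (volume : Measure ℝ)).IsAddHaarMeasure

/-- The support stays away from `t = T` but may cross `t = 0`. This is how the initial condition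
enters the distributional equation. -/
theorem isTestFunction_of_smooth {T : ℝ} {ψ : SpaceTime n → ℝ} (hψ : ContDiff ℝ ∞ ψ)
    (hψs : HasCompactSupport ψ) (hψT : tsupport ψ ⊆ {p | p.2 < T}) :
    IsTestFunction T ψ (heatOp (timeVec n) (spaceVec n) ψ) where
  continuousOn := hψ.continuous.continuousOn
  compactSupport := ⟨tsupport ψ, hψs, fun _ _ hp => image_eq_zero_of_notMem_tsupport hp⟩
  final x := image_eq_zero_of_notMem_tsupport fun h => lt_irrefl T (hψT h)
  backwardHeat := by
    intro χ hχ hχs hχQ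
    have h0 : ∀ p, p ∉ Q n T → χ p = 0 := fun p hp =>
      image_eq_zero_of_notMem_tsupport fun h => hp (hχQ h)
    have h1 : ∀ p, p ∉ Q n T → heatOp (-timeVec n) (spaceVec n) χ p = 0 := fun p hp => by
      by_contra h
      exact hp (hχQ (support_heatOp_subset _ _ _ h))
    simp only [← heatOp_eq hχ]
    rw [setIntegral_eq_integral_of_forall_compl_eq_zero fun p hp => by rw [h1 p hp, mul_zero],
      setIntegral_eq_integral_of_forall_compl_eq_zero fun p hp => by rw [h0 p hp, mul_zero],
      integral_mul_heatOp _ _ hψ hχ hχs, neg_neg]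
  locallyBounded := by
    have hc := (contDiff_heatOp (timeVec n) (spaceVec n) hψ).continuous
    obtain ⟨C, hC⟩ := (hasCompactSupport_heatOp (timeVec n) (spaceVec n) hψs).exists_bound_of_continuous hc
    exact ⟨hc.aestronglyMeasurable, fun K _ _ => ⟨C, Filter.Eventually.of_forall hC⟩⟩

theorem locallyIntegrable_indicator_Q {T : ℝ} {f : SpaceTime n → ℝ}
    (hf : LocallyIntegrableOn f (closedQ n T)) : LocallyIntegrable ((Q n T).indicator f) := by
  rw [locallyIntegrable_iff]
  intro K hK
  have hcl : IsClosed (closedQ n T) := isClosed_univ.prod isClosed_Icc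
  have h1 := hf.integrableOn_compact_subset inter_subset_right (hK.inter_right hcl)
  rw [IntegrableOn, integrable_indicator_iff (isOpen_Q n T).measurableSet, IntegrableOn,
    Measure.restrict_restrict (isOpen_Q n T).measurableSet, inter_comm]
  exact h1.mono_set (inter_subset_inter_right _ (Q_subset_closedQ n T))

theorem setIntegral_Q_mul (T : ℝ) (f g : SpaceTime n → ℝ) :
    ∫ p in Q n T, f p * g p = ∫ p, (Q n T).indicator f p * g p := by
  rw [← integral_indicator (isOpen_Q n T).measurableSet]
  simp only [indicator_mul_left]

/-- The difference of two weak solutions with the same initial measure, extended by zero, solves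
the equation for all times `t < T`. -/
theorem IsWeakSolution.isDistribSolution_sub {T : ℝ} {V u₁ u₂ : SpaceTime n → ℝ}
    {μ : SignedRadonMeasure n} (h₁ : IsWeakSolution T V μ u₁) (h₂ : IsWeakSolution T V μ u₂) :
    IsDistribSolution volume (timeVec n) (spaceVec n) {p | p.2 < T}
      ((Q n T).indicator fun p => u₁ p - u₂ p)
      ((Q n T).indicator fun p => V p * u₁ p - V p * u₂ p) := by
  intro ψ hψ hψs hψT
  have ht := isTestFunction_of_smooth hψ hψs hψT
  -- Both weak formulations equal the same integral against `μ`, which is thereby eliminated.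
  have e := (h₁.weakForm _ _ ht).trans (h₂.weakForm _ _ ht).symm
  simp only [setIntegral_Q_mul] at e
  have hi : ∀ f : SpaceTime n → ℝ, LocallyIntegrableOn f (closedQ n T) → ∀ g : SpaceTime n → ℝ,
      Continuous g → HasCompactSupport g →
      Integrable fun p => (Q n T).indicator f p * g p := fun f hf g hg hgs => by
    simpa [mul_comm] using (locallyIntegrable_indicator_Q
      hf).integrable_smul_left_of_hasCompactSupport hg hgs
  have hPc := (contDiff_heatOp (timeVec n) (spaceVec n) hψ).continuous
  have hPs := hasCompactSupport_heatOp (timeVec n) (spaceVec n) hψs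
  have hs : ∀ f g : SpaceTime n → ℝ, ∀ p, (Q n T).indicator (fun p => f p - g p) p
      = (Q n T).indicator f p - (Q n T).indicator g p := fun f g p =>
    congrFun (indicator_sub (Q n T) f g) p
  simp only [hs, sub_mul]
  rw [integral_sub (hi _ h₁.locallyIntegrable _ hPc hPs) (hi _ h₂.locallyIntegrable _ hPc hPs),
    integral_sub (hi _ h₁.locallyIntegrable_potential _ hψ.continuous hψs)
      (hi _ h₂.locallyIntegrable_potential _ hψ.continuous hψs)]
  linarith

end WeakForm

/-! ### Gaussian weights with space and time cutoffs. -/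

section Barrier

open Filter Topology

variable {n : ℕ}

/-- The function `γ t + (α + β t) |x|²`. -/
def quadPoly (n : ℕ) (γ α β : ℝ) (p : SpaceTime n) : ℝ := γ * p.2 + (α + β * p.2) * ‖p.1‖ ^ 2

theorem contDiff_quadPoly (γ α β : ℝ) : ContDiff ℝ ∞ (quadPoly n γ α β) := by
  have h : ContDiff ℝ ∞ fun p : SpaceTime n => ‖p.1‖ ^ 2 := contDiff_fst.norm_sq ℝ
  have h2 : ContDiff ℝ ∞ fun p : SpaceTime n => p.2 := contDiff_snd
  exact (contDiff_const.mul h2).add ((contDiff_const.add (contDiff_const.mul h2)).mul h)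

theorem dirDeriv_quadPoly (γ α β : ℝ) (v p : SpaceTime n) :
    dirDeriv v (quadPoly n γ α β) p
      = γ * v.2 + β * v.2 * ‖p.1‖ ^ 2 + (α + β * p.2) * (2 * inner ℝ p.1 v.1) := by
  have h : HasFDerivAt (fun p : SpaceTime n => ‖p.1‖ ^ 2)
      ((2 • innerSL ℝ p.1).comp (ContinuousLinearMap.fst ℝ _ ℝ)) p :=
    HasFDerivAt.comp (g := fun x : EuclideanSpace ℝ (Fin n) => ‖x‖ ^ 2) p
      (hasStrictFDerivAt_norm_sq p.1).hasFDerivAt hasFDerivAt_fst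
  have h2 : HasFDerivAt (fun p : SpaceTime n => p.2) (ContinuousLinearMap.snd ℝ _ ℝ) p :=
    hasFDerivAt_snd
  have := ((h2.const_mul γ).add (((h2.const_mul β).const_add α).mul h)).fderiv
  change fderiv ℝ (fun p : SpaceTime n => γ * p.2 + (α + β * p.2) * ‖p.1‖ ^ 2) p v = _
  refine (congrArg (fun L => L v) this).trans ?_
  simp
  ring

theorem dirDeriv_timeVec_quadPoly (γ α β : ℝ) (p : SpaceTime n) :
    dirDeriv (timeVec n) (quadPoly n γ α β) p = γ + β * ‖p.1‖ ^ 2 := by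
  simp [dirDeriv_quadPoly, timeVec]

theorem dirDeriv_spaceVec_quadPoly (γ α β : ℝ) (i : Fin n) (p : SpaceTime n) :
    dirDeriv (spaceVec n i) (quadPoly n γ α β) p = 2 * (α + β * p.2) * p.1 i := by
  simp [dirDeriv_quadPoly, spaceVec, EuclideanSpace.inner_single_right]
  ring

theorem dirDeriv_dirDeriv_quadPoly (γ α β : ℝ) (i : Fin n) (p : SpaceTime n) :
    dirDeriv (spaceVec n i) (dirDeriv (spaceVec n i) (quadPoly n γ α β)) p
      = 2 * (α + β * p.2) := by
  have h1 : HasFDerivAt (fun p : SpaceTime n => p.1 i)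
      ((EuclideanSpace.proj i : EuclideanSpace ℝ (Fin n) →L[ℝ] ℝ).comp
        (ContinuousLinearMap.fst ℝ _ ℝ)) p :=
    ((EuclideanSpace.proj i : EuclideanSpace ℝ (Fin n) →L[ℝ] ℝ).comp
      (ContinuousLinearMap.fst ℝ _ ℝ)).hasFDerivAt
  have h2 : HasFDerivAt (fun p : SpaceTime n => p.2) (ContinuousLinearMap.snd ℝ _ ℝ) p :=
    hasFDerivAt_snd
  have := ((((h2.const_mul β).const_add α).const_mul 2).mul h1).fderiv
  rw [show dirDeriv (spaceVec n i) (quadPoly n γ α β)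
    = fun p : SpaceTime n => 2 * (α + β * p.2) * p.1 i from
    funext (dirDeriv_spaceVec_quadPoly γ α β i)]
  refine (congrArg (fun L => L (spaceVec n i)) this).trans ?_
  simp [spaceVec]

theorem sum_sq_dirDeriv_quadPoly (γ α β : ℝ) (p : SpaceTime n) :
    ∑ i, dirDeriv (spaceVec n i) (quadPoly n γ α β) p ^ 2
      = 4 * (α + β * p.2) ^ 2 * ‖p.1‖ ^ 2 := by
  simp only [dirDeriv_spaceVec_quadPoly, mul_pow, ← Finset.mul_sum, EuclideanSpace.real_norm_sq_eq]
  ring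

theorem heatOp_quadPoly (γ α β : ℝ) (p : SpaceTime n) :
    heatOp (timeVec n) (spaceVec n) (quadPoly n γ α β) p
      = γ + β * ‖p.1‖ ^ 2 + 2 * n * (α + β * p.2) := by
  simp only [heatOp, dirDeriv_timeVec_quadPoly, dirDeriv_dirDeriv_quadPoly, Finset.sum_const,
    Finset.card_univ, Fintype.card_fin, nsmul_eq_mul]
  ring

/-- The Gaussian `exp (γ t + (α + β t) |x|²)` times a space cutoff times a time cutoff. -/
def barrier (n : ℕ) (γ α β c : ℝ) (s χ : ℝ → ℝ) (p : SpaceTime n) : ℝ :=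
  Real.exp (quadPoly n γ α β p) * s (quadPoly n 0 c 0 p) * χ (quadPoly n 1 0 0 p)

theorem contDiff_barrier (γ α β c : ℝ) {s χ : ℝ → ℝ} (hs : ContDiff ℝ ∞ s) (hχ : ContDiff ℝ ∞ χ) :
    ContDiff ℝ ∞ (barrier n γ α β c s χ) :=
  ((Real.contDiff_exp.comp (contDiff_quadPoly γ α β)).mul
    (hs.comp (contDiff_quadPoly 0 c 0))).mul (hχ.comp (contDiff_quadPoly 1 0 0))

/-- The coefficient `8 (α + β t) c |x|²` is twice the product of the gradients `2 (α + β t) x` and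
`2 c x` of the two quadratic exponents. The time cutoff has no space gradient, hence no cross term.
-/
theorem heatOp_barrier (γ α β c : ℝ) {s χ : ℝ → ℝ} (hs : ContDiff ℝ ∞ s) (hχ : ContDiff ℝ ∞ χ)
    (p : SpaceTime n) :
    heatOp (timeVec n) (spaceVec n) (barrier n γ α β c s χ) p
      = Real.exp (quadPoly n γ α β p) *
        (χ p.2 * ((γ + β * ‖p.1‖ ^ 2 + 2 * n * (α + β * p.2)
            + 4 * (α + β * p.2) ^ 2 * ‖p.1‖ ^ 2) * s (c * ‖p.1‖ ^ 2)
          + (2 * n * c + 8 * (α + β * p.2) * (c * ‖p.1‖ ^ 2)) * deriv s (c * ‖p.1‖ ^ 2)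
          + 4 * c * (c * ‖p.1‖ ^ 2) * deriv (deriv s) (c * ‖p.1‖ ^ 2))
        + s (c * ‖p.1‖ ^ 2) * deriv χ p.2) := by
  have hA := contDiff_quadPoly (n := n) γ α β
  have hc := contDiff_quadPoly (n := n) 0 c 0
  have ht := contDiff_quadPoly (n := n) 1 0 0
  have hE : ContDiff ℝ ∞ fun p => Real.exp (quadPoly n γ α β p) := Real.contDiff_exp.comp hA
  have hS : ContDiff ℝ ∞ fun p => s (quadPoly n 0 c 0 p) := hs.comp hc
  have hX : ContDiff ℝ ∞ fun p => χ (quadPoly n 1 0 0 p) := hχ.comp ht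
  have qc : ∀ p : SpaceTime n, quadPoly n 0 c 0 p = c * ‖p.1‖ ^ 2 := fun p => by simp [quadPoly]
  have qt : ∀ p : SpaceTime n, quadPoly n 1 0 0 p = p.2 := fun p => by simp [quadPoly]
  have hsq : ∑ i, p.1 i ^ 2 = ‖p.1‖ ^ 2 := (EuclideanSpace.real_norm_sq_eq p.1).symm
  have hcross : ∑ i, dirDeriv (spaceVec n i) (fun p => Real.exp (quadPoly n γ α β p)) p
      * dirDeriv (spaceVec n i) (fun p => s (quadPoly n 0 c 0 p)) p
      = Real.exp (quadPoly n γ α β p) * deriv s (c * ‖p.1‖ ^ 2)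
        * (4 * (α + β * p.2) * (c * ‖p.1‖ ^ 2)) := by
    rw [← hsq, Finset.mul_sum, Finset.mul_sum, Finset.mul_sum]
    refine Finset.sum_congr rfl fun i _ => ?_
    rw [dirDeriv_comp _ Real.contDiff_exp hA, dirDeriv_comp _ hs hc]
    simp only [dirDeriv_spaceVec_quadPoly, qc, Real.deriv_exp, ← hsq, ← Finset.mul_sum]
    ring
  have hzero : ∀ i, dirDeriv (spaceVec n i) (fun p => χ (quadPoly n 1 0 0 p)) p = 0 := fun i => by
    rw [dirDeriv_comp _ hχ ht]
    simp [dirDeriv_spaceVec_quadPoly]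
  change heatOp (timeVec n) (spaceVec n) (fun p => Real.exp (quadPoly n γ α β p)
    * s (quadPoly n 0 c 0 p) * χ (quadPoly n 1 0 0 p)) p = _
  rw [heatOp_mul (f := fun p => Real.exp (quadPoly n γ α β p) * s (quadPoly n 0 c 0 p)) _ _
    (hE.mul hS) hX, heatOp_mul _ _ hE hS, hcross, heatOp_comp _ _ Real.contDiff_exp hA,
    heatOp_comp _ _ hs hc, heatOp_comp _ _ hχ ht]
  simp only [hzero, mul_zero, Finset.sum_const_zero]
  simp only [sum_sq_dirDeriv_quadPoly, heatOp_quadPoly, qc, qt, Real.deriv_exp]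
  ring

/-- The space cutoff as a function of `c |x|²`. -/
def spaceCutoff (r : ℝ) : ℝ := Real.smoothTransition (2 - r)

theorem contDiff_spaceCutoff : ContDiff ℝ ∞ spaceCutoff :=
  Real.smoothTransition.contDiff.comp (contDiff_const.sub contDiff_id)

theorem spaceCutoff_eq_one {r : ℝ} (hr : r ≤ 1) : spaceCutoff r = 1 :=
  Real.smoothTransition.one_of_one_le (by linarith)

theorem spaceCutoff_eq_zero {r : ℝ} (hr : 2 ≤ r) : spaceCutoff r = 0 :=
  Real.smoothTransition.zero_of_nonpos (by linarith)

theorem deriv_spaceCutoff_of_lt {r : ℝ} (hr : r < 1) : deriv spaceCutoff r = 0 := by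
  have : spaceCutoff =ᶠ[𝓝 r] fun _ => 1 := by
    filter_upwards [eventually_lt_nhds hr] with x hx using spaceCutoff_eq_one hx.le
  simp [this.deriv_eq]

theorem deriv_deriv_spaceCutoff_of_lt {r : ℝ} (hr : r < 1) : deriv (deriv spaceCutoff) r = 0 := by
  have : deriv spaceCutoff =ᶠ[𝓝 r] fun _ => 0 := by
    filter_upwards [eventually_lt_nhds hr] with x hx using deriv_spaceCutoff_of_lt hx
  simp [this.deriv_eq]

theorem hasCompactSupport_deriv_spaceCutoff : HasCompactSupport (deriv spaceCutoff) := by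
  refine HasCompactSupport.of_support_subset_isCompact (isCompact_Icc (a := (1 : ℝ)) (b := 2))
    fun r hr => ⟨?_, ?_⟩
  · by_contra! h
    exact hr (deriv_spaceCutoff_of_lt h)
  · by_contra! h
    refine hr ?_
    have : spaceCutoff =ᶠ[𝓝 r] fun _ => 0 := by
      filter_upwards [eventually_gt_nhds h] with x hx using spaceCutoff_eq_zero hx.le
    simp [this.deriv_eq]

/-- The time cutoff, supported in `[-b, b]`. -/
def timeCutoff (b t : ℝ) : ℝ := expNegInvGlue (b ^ 2 - t ^ 2)

theorem contDiff_timeCutoff (b : ℝ) : ContDiff ℝ ∞ (timeCutoff b) :=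
  expNegInvGlue.contDiff.comp (contDiff_const.sub (contDiff_id.pow 2))

theorem timeCutoff_nonneg (b t : ℝ) : 0 ≤ timeCutoff b t := expNegInvGlue.nonneg _

theorem timeCutoff_pos {b t : ℝ} (h : |t| < b) : 0 < timeCutoff b t := by
  refine expNegInvGlue.pos_of_pos (sub_pos.2 ?_)
  rw [← sq_abs t]
  exact pow_lt_pow_left₀ h (abs_nonneg t) two_ne_zero

theorem abs_lt_of_timeCutoff_ne_zero {b t : ℝ} (hb : 0 ≤ b) (h : timeCutoff b t ≠ 0) :
    |t| < b := by
  by_contra! h'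
  refine h (expNegInvGlue.zero_of_nonpos (sub_nonpos.2 ?_))
  rw [← sq_abs t]
  exact pow_le_pow_left₀ hb h' 2

theorem timeCutoff_le (b t : ℝ) : timeCutoff b t ≤ expNegInvGlue (b ^ 2) :=
  expNegInvGlue.monotone (by nlinarith [sq_nonneg t])

/-- The cutoff is an increasing function of `b² - t²`. This sign allows the term containing its
derivative to be discarded for `t ≥ 0`. -/
theorem deriv_timeCutoff_nonpos (b : ℝ) {t : ℝ} (ht : 0 ≤ t) : deriv (timeCutoff b) t ≤ 0 := by
  have h1 : HasDerivAt (fun t : ℝ => b ^ 2 - t ^ 2) (-(2 * t)) t := by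
    simpa using ((hasDerivAt_id t).pow 2).const_sub (b ^ 2)
  have hd : Differentiable ℝ expNegInvGlue :=
    (expNegInvGlue.contDiff (n := 1)).differentiable (by simp)
  have h2 := (HasDerivAt.comp t (hd (b ^ 2 - t ^ 2)).hasDerivAt h1).deriv
  change deriv (expNegInvGlue ∘ fun t : ℝ => b ^ 2 - t ^ 2) t ≤ 0
  rw [h2]
  have := expNegInvGlue.monotone.deriv_nonneg (x := b ^ 2 - t ^ 2)
  nlinarith

theorem barrier_ne_zero {γ α β c b : ℝ} (hb : 0 ≤ b) {p : SpaceTime n}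
    (hp : barrier n γ α β c spaceCutoff (timeCutoff b) p ≠ 0) :
    c * ‖p.1‖ ^ 2 < 2 ∧ |p.2| < b := by
  have h1 := right_ne_zero_of_mul hp
  have h2 := right_ne_zero_of_mul (left_ne_zero_of_mul hp)
  simp only [quadPoly, one_mul, zero_mul, add_zero, zero_add] at h1 h2
  refine ⟨?_, abs_lt_of_timeCutoff_ne_zero hb h1⟩
  by_contra! h
  exact h2 (spaceCutoff_eq_zero h)

theorem support_barrier_subset {γ α β c b : ℝ} (hb : 0 ≤ b) (hc : 0 < c) :
    Function.support (barrier n γ α β c spaceCutoff (timeCutoff b))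
      ⊆ Metric.closedBall 0 (√(2 / c)) ×ˢ Icc (-b) b := fun p hp => by
  obtain ⟨h1, h2⟩ := barrier_ne_zero hb hp
  refine ⟨?_, abs_le.1 h2.le⟩
  rw [mem_closedBall_zero_iff]
  refine Real.le_sqrt_of_sq_le ?_
  rw [le_div_iff₀ hc]
  linarith

theorem barrier_nonneg (γ α β c b : ℝ) (p : SpaceTime n) :
    0 ≤ barrier n γ α β c spaceCutoff (timeCutoff b) p :=
  mul_nonneg (mul_nonneg (Real.exp_nonneg _) (Real.smoothTransition.nonneg _))
    (timeCutoff_nonneg _ _)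

end Barrier

/-! ### Vanishing of subsolutions of Gaussian growth, and uniqueness. -/

section Uniqueness

open Filter Topology

variable {n : ℕ}

/-- An upper bound, up to the Gaussian and the time cutoff, for `∂ₜ + Δ` of the barrier with decay
rate `a`, where `c` is the scale of the space cutoff and `q = |x|²`. -/
def barrierBound (n : ℕ) (c a q : ℝ) : ℝ :=
  -spaceCutoff (c * q) + (2 * n * c - 8 * a * (c * q)) * deriv spaceCutoff (c * q)
    + 4 * c * (c * q) * deriv (deriv spaceCutoff) (c * q)

theorem heatOp_barrier_le {l t₀ b c : ℝ} {p : SpaceTime n} (hl : 0 < l) (hb : 0 ≤ b)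
    (hbt : b - t₀ ≤ 1 / (16 * l)) (hp0 : 0 ≤ p.2) (hp : t₀ ≤ p.2) :
    heatOp (timeVec n) (spaceVec n)
        (barrier n (-1) (-l + 16 * l ^ 2 * t₀) (-(16 * l ^ 2)) c spaceCutoff (timeCutoff b)) p
      ≤ Real.exp (quadPoly n (-1) (-l + 16 * l ^ 2 * t₀) (-(16 * l ^ 2)) p) *
        (timeCutoff b p.2 * barrierBound n c (l + 16 * l ^ 2 * (p.2 - t₀)) (‖p.1‖ ^ 2)) := by
  rw [heatOp_barrier _ _ _ _ contDiff_spaceCutoff (contDiff_timeCutoff b)]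
  refine mul_le_mul_of_nonneg_left ?_ (Real.exp_nonneg _)
  have hS0 : 0 ≤ spaceCutoff (c * ‖p.1‖ ^ 2) := Real.smoothTransition.nonneg _
  have hχ := mul_nonpos_of_nonneg_of_nonpos hS0 (deriv_timeCutoff_nonpos b hp0)
  by_cases hz : timeCutoff b p.2 = 0
  · rw [hz]; linarith
  have hpb := (le_abs_self p.2).trans_lt (abs_lt_of_timeCutoff_ne_zero hb hz)
  have ha0 : 0 ≤ l + 16 * l ^ 2 * (p.2 - t₀) := by
    have := sub_nonneg.2 hp
    positivity
  have ha1 : l + 16 * l ^ 2 * (p.2 - t₀) ≤ 2 * l := by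
    have h1 : (p.2 - t₀) * (16 * l) ≤ 1 := by
      rw [← le_div_iff₀ (by positivity)]
      linarith
    nlinarith
  have hq := sq_nonneg ‖p.1‖
  -- With `a = l + 16 l² (t - t₀)` in `[0, 2l]`, the term `4a²|x|²` is absorbed by `-16 l² |x|²`,
  -- and `-2na ≤ 0`. The factor `exp(-t)` supplies the remaining `-1`.
  have hcoef : -1 + -(16 * l ^ 2) * ‖p.1‖ ^ 2
      + 2 * n * (-l + 16 * l ^ 2 * t₀ + -(16 * l ^ 2) * p.2)
      + 4 * (-l + 16 * l ^ 2 * t₀ + -(16 * l ^ 2) * p.2) ^ 2 * ‖p.1‖ ^ 2 ≤ -1 := by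
    have e : -l + 16 * l ^ 2 * t₀ + -(16 * l ^ 2) * p.2 = -(l + 16 * l ^ 2 * (p.2 - t₀)) := by
      ring
    rw [e]
    have h1 : (l + 16 * l ^ 2 * (p.2 - t₀)) ^ 2 ≤ (2 * l) ^ 2 := pow_le_pow_left₀ ha0 ha1 2
    have h2 := mul_le_mul_of_nonneg_right h1 hq
    have h3 := mul_nonneg (Nat.cast_nonneg n : (0 : ℝ) ≤ n) ha0
    nlinarith
  have h1 := mul_le_mul_of_nonneg_left (mul_le_mul_of_nonneg_right hcoef hS0)
    (timeCutoff_nonneg b p.2)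
  simp only [barrierBound]
  linarith

/-- In the variable `r = c q` the unbounded factor `q` occurs only through `r s'(r)` and `r s''(r)`,
with `s` the space cutoff; these are continuous with compact support. The remaining factors `c` are
at most `1`, so the bound is uniform in `c` and `q`. The terms need not become small: boundedness
suffices for dominated convergence. -/
theorem exists_abs_barrierBound_le (n : ℕ) (A : ℝ) : ∃ C, ∀ c a q : ℝ, 0 ≤ c → c ≤ 1 → |a| ≤ A →
    |barrierBound n c a q| ≤ C := by
  have hc := contDiff_deriv contDiff_spaceCutoff
  have hs := hasCompactSupport_deriv_spaceCutoff
  obtain ⟨C₁, h₁⟩ := hs.exists_bound_of_continuous hc.continuous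
  obtain ⟨C₂, h₂⟩ := (hs.mul_left (f := fun r => r)).exists_bound_of_continuous
    (continuous_id.mul hc.continuous)
  obtain ⟨C₃, h₃⟩ := (hs.deriv.mul_left (f := fun r => r)).exists_bound_of_continuous
    (continuous_id.mul (contDiff_deriv hc).continuous)
  simp only [Pi.mul_apply, Real.norm_eq_abs] at h₁ h₂ h₃
  refine ⟨1 + (2 * n * C₁ + 8 * (A * C₂)) + 4 * C₃, fun c a q hc0 hc1 ha => ?_⟩
  have e : barrierBound n c a q = -spaceCutoff (c * q)
      + (2 * n * (c * deriv spaceCutoff (c * q)) - 8 * (a * (c * q * deriv spaceCutoff (c * q))))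
      + 4 * (c * (c * q * deriv (deriv spaceCutoff) (c * q))) := by
    simp only [barrierBound]; ring
  rw [e]
  have b0 : |spaceCutoff (c * q)| ≤ 1 := by
    have hS0 : 0 ≤ spaceCutoff (c * q) := Real.smoothTransition.nonneg _
    rw [abs_of_nonneg hS0]
    exact Real.smoothTransition.le_one _
  have hcle : ∀ r C : ℝ, |r| ≤ C → |c * r| ≤ C := fun r C h => by
    rw [abs_mul, abs_of_nonneg hc0]
    exact (mul_le_of_le_one_left (abs_nonneg _) hc1).trans h
  have b1 := hcle _ _ (h₁ (c * q))
  have b2 : |a * (c * q * deriv spaceCutoff (c * q))| ≤ A * C₂ := by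
    rw [abs_mul]
    exact mul_le_mul ha (h₂ _) (abs_nonneg _) ((abs_nonneg _).trans ha)
  have b3 := hcle _ _ (h₃ (c * q))
  have hn : (0 : ℝ) ≤ n := Nat.cast_nonneg n
  have b1' : |(n : ℝ) * (c * deriv spaceCutoff (c * q))| ≤ n * C₁ := by
    rw [abs_mul, Nat.abs_cast]
    exact mul_le_mul_of_nonneg_left b1 hn
  rw [abs_le] at b0 b1' b2 b3 ⊢
  constructor <;> linarith

theorem barrierBound_of_lt {c a q : ℝ} (h : c * q < 1) : barrierBound n c a q = -1 := by
  simp [barrierBound, spaceCutoff_eq_one h.le, deriv_spaceCutoff_of_lt h,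
    deriv_deriv_spaceCutoff_of_lt h]

theorem continuous_barrierBound (c : ℝ) {a q : SpaceTime n → ℝ} (ha : Continuous a)
    (hq : Continuous q) : Continuous fun p => barrierBound n c (a p) (q p) := by
  have h0 : Continuous spaceCutoff := contDiff_spaceCutoff.continuous
  have h1 := (contDiff_deriv contDiff_spaceCutoff).continuous
  have h2 := (contDiff_deriv (contDiff_deriv contDiff_spaceCutoff)).continuous
  unfold barrierBound
  fun_prop

/-- `w` is a subsolution of the heat equation for `t < T` in the sense of distributions. -/
def IsHeatSubsolution (T : ℝ) (w : SpaceTime n → ℝ) : Prop :=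
  ∀ φ : SpaceTime n → ℝ, ContDiff ℝ ∞ φ → HasCompactSupport φ → tsupport φ ⊆ {p | p.2 < T} →
    (∀ p, 0 ≤ φ p) → 0 ≤ ∫ p, w p * heatOp (timeVec n) (spaceVec n) φ p

/-- A nonnegative subsolution of Gaussian growth which vanishes for `t < t₀` vanishes for
`t < t₁` if `t₁ - t₀` is small. -/
theorem IsHeatSubsolution.ae_eq_zero_step {T l t₀ t₁ : ℝ} {w : SpaceTime n → ℝ}
    (hw : IsHeatSubsolution T w) (hw0 : ∀ p, 0 ≤ w p) (hwl : LocallyIntegrable w)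
    (hwt : ∀ p, p.2 ≤ 0 → w p = 0) (hl : 0 < l)
    (hint : Integrable fun p => Real.exp (-l * ‖p.1‖ ^ 2) * w p) (ht₁ : 0 < t₁) (htT : t₁ < T)
    (ht : t₁ - t₀ ≤ 1 / (16 * l)) (h0 : ∀ᵐ p : SpaceTime n, p.2 < t₀ → w p = 0) :
    ∀ᵐ p : SpaceTime n, p.2 < t₁ → w p = 0 := by
  set c : ℕ → ℝ := fun m => 1 / ((m : ℝ) + 1) with hc
  have hc0 : ∀ m, 0 < c m := fun m => by positivity
  have hc1 : ∀ m, c m ≤ 1 := fun m => by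
    rw [hc, div_le_one (by positivity)]
    linarith [(Nat.cast_nonneg m : (0 : ℝ) ≤ m)]
  set h : SpaceTime n → ℝ := fun p =>
    Real.exp (quadPoly n (-1) (-l + 16 * l ^ 2 * t₀) (-(16 * l ^ 2)) p) with hh
  set a : SpaceTime n → ℝ := fun p => l + 16 * l ^ 2 * (p.2 - t₀) with ha
  set F : ℕ → SpaceTime n → ℝ := fun m p =>
    w p * (h p * (timeCutoff t₁ p.2 * barrierBound n (c m) (a p) (‖p.1‖ ^ 2))) with hF
  have hhc : Continuous h := Real.continuous_exp.comp (contDiff_quadPoly _ _ _).continuous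
  have hχc : Continuous (timeCutoff t₁) := (contDiff_timeCutoff t₁).continuous
  obtain ⟨C, hC⟩ := exists_abs_barrierBound_le n (2 * l)
  set B := expNegInvGlue (t₁ ^ 2) with hB
  -- Where `F m` is nonzero, almost everywhere `0 < t < t₁` and `t₀ ≤ t`. There `l ≤ a ≤ 2l`, so `h`
  -- is at most `exp(-l|x|²)` and the majorant is integrable by `hint`.
  have hbound : ∀ m, ∀ᵐ p, ‖F m p‖ ≤ Real.exp (-l * ‖p.1‖ ^ 2) * w p * (B * C) := fun m => by
    have hC0 : 0 ≤ C := (abs_nonneg _).trans (hC 0 0 0 le_rfl zero_le_one (by simp [hl.le]))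
    have hB0 : 0 ≤ B := expNegInvGlue.nonneg _
    filter_upwards [h0] with p hp
    have hr : 0 ≤ Real.exp (-l * ‖p.1‖ ^ 2) * w p * (B * C) :=
      mul_nonneg (mul_nonneg (Real.exp_nonneg _) (hw0 p)) (mul_nonneg hB0 hC0)
    by_cases hwp : w p = 0
    · simp [hF, hwp]
    by_cases hz : timeCutoff t₁ p.2 = 0
    · simpa [hF, hz] using hr
    have hp0 : 0 < p.2 := by
      by_contra! h'
      exact hwp (hwt p h')
    have hpt : t₀ ≤ p.2 := by
      by_contra! h'
      exact hwp (hp h')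
    have hpb := (le_abs_self p.2).trans_lt (abs_lt_of_timeCutoff_ne_zero ht₁.le hz)
    have hal : l ≤ a p := by
      have := sub_nonneg.2 hpt
      have : 0 ≤ 16 * l ^ 2 * (p.2 - t₀) := by positivity
      simp only [ha]; linarith
    have ha1 : a p ≤ 2 * l := by
      have h1 : (p.2 - t₀) * (16 * l) ≤ 1 := by
        rw [← le_div_iff₀ (by positivity)]
        linarith
      simp only [ha]
      nlinarith
    have hhle : h p ≤ Real.exp (-l * ‖p.1‖ ^ 2) := by
      refine Real.exp_le_exp.2 ?_
      have e : quadPoly n (-1) (-l + 16 * l ^ 2 * t₀) (-(16 * l ^ 2)) p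
          = -p.2 - a p * ‖p.1‖ ^ 2 := by
        simp only [quadPoly, ha]; ring
      rw [e]
      nlinarith [mul_le_mul_of_nonneg_right hal (sq_nonneg ‖p.1‖)]
    have hbb := hC (c m) (a p) (‖p.1‖ ^ 2) (hc0 m).le (hc1 m)
      (by rw [abs_of_nonneg (hl.le.trans hal)]; exact ha1)
    have h1 : timeCutoff t₁ p.2 * |barrierBound n (c m) (a p) (‖p.1‖ ^ 2)| ≤ B * C :=
      mul_le_mul (timeCutoff_le _ _) hbb (abs_nonneg _) hB0
    have hh0 : 0 ≤ h p := Real.exp_nonneg _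
    simp only [hF, norm_mul, Real.norm_eq_abs, abs_of_nonneg (hw0 p),
      abs_of_nonneg (timeCutoff_nonneg t₁ p.2), abs_of_nonneg hh0]
    calc w p * (h p * (timeCutoff t₁ p.2 * |barrierBound n (c m) (a p) (‖p.1‖ ^ 2)|))
        ≤ w p * (Real.exp (-l * ‖p.1‖ ^ 2) * (B * C)) :=
          mul_le_mul_of_nonneg_left (mul_le_mul hhle h1
            (mul_nonneg (timeCutoff_nonneg _ _) (abs_nonneg _)) (Real.exp_nonneg _)) (hw0 p)
      _ = Real.exp (-l * ‖p.1‖ ^ 2) * w p * (B * C) := by ring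
  have hFm : ∀ m, AEStronglyMeasurable (F m) := fun m =>
    hwl.aestronglyMeasurable.mul (hhc.mul ((hχc.comp continuous_snd).mul
      (continuous_barrierBound (c m) (by fun_prop) (by fun_prop)))).aestronglyMeasurable
  have hFi : ∀ m, Integrable (F m) := fun m =>
    (hint.mul_const (B * C)).mono' (hFm m) (hbound m)
  have hFnonneg : ∀ m, 0 ≤ ∫ p, F m p := fun m => by
    have hsm := contDiff_barrier (n := n) (-1) (-l + 16 * l ^ 2 * t₀) (-(16 * l ^ 2)) (c m)
      contDiff_spaceCutoff (contDiff_timeCutoff t₁)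
    have hsub := support_barrier_subset (n := n) (γ := -1) (α := -l + 16 * l ^ 2 * t₀)
      (β := -(16 * l ^ 2)) ht₁.le (hc0 m)
    have hcpt : IsCompact (Metric.closedBall (0 : EuclideanSpace ℝ (Fin n)) (√(2 / c m))
        ×ˢ Icc (-t₁) t₁) := (isCompact_closedBall _ _).prod isCompact_Icc
    have hcs := HasCompactSupport.of_support_subset_isCompact hcpt hsub
    refine (hw _ hsm hcs ((closure_minimal hsub hcpt.isClosed).trans fun p hp =>
      hp.2.2.trans_lt htT) (barrier_nonneg _ _ _ _ _)).trans ?_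
    have hi : Integrable fun p => w p * heatOp (timeVec n) (spaceVec n)
        (barrier n (-1) (-l + 16 * l ^ 2 * t₀) (-(16 * l ^ 2)) (c m) spaceCutoff
          (timeCutoff t₁)) p := by
      simpa [mul_comm] using hwl.integrable_smul_left_of_hasCompactSupport
        (contDiff_heatOp (timeVec n) (spaceVec n) hsm).continuous
        (hasCompactSupport_heatOp (timeVec n) (spaceVec n) hcs)
    refine integral_mono_ae hi (hFi m) ?_
    filter_upwards [h0] with p hp
    by_cases hwp : w p = 0
    · simp [hF, hwp]
    refine mul_le_mul_of_nonneg_left (heatOp_barrier_le hl ht₁.le ht ?_ ?_) (hw0 p)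
    · by_contra! h'
      exact hwp (hwt p h'.le)
    · by_contra! h'
      exact hwp (hp h')
  -- For fixed `p` the sequence is eventually constant: once `c m |x|² < 1`, the space cutoff is
  -- identically `1` near the point.
  have hpt : ∀ p, Tendsto (fun m => F m p) atTop (𝓝 (-(w p * (h p * timeCutoff t₁ p.2)))) := by
    intro p
    refine tendsto_const_nhds.congr' ?_
    have : Tendsto (fun m => c m * ‖p.1‖ ^ 2) atTop (𝓝 (0 * ‖p.1‖ ^ 2)) :=
      (tendsto_one_div_add_atTop_nhds_zero_nat (𝕜 := ℝ)).mul_const (‖p.1‖ ^ 2)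
    rw [zero_mul] at this
    filter_upwards [this.eventually (eventually_lt_nhds zero_lt_one)] with m hm
    simp only [hF, barrierBound_of_lt hm]
    ring
  have hlim : Tendsto (fun m => ∫ p, F m p) atTop
      (𝓝 (∫ p, -(w p * (h p * timeCutoff t₁ p.2)))) :=
    tendsto_integral_of_dominated_convergence _ hFm (hint.mul_const (B * C)) hbound
      (Eventually.of_forall hpt)
  have hle := ge_of_tendsto' hlim hFnonneg
  rw [integral_neg, neg_nonneg] at hle
  have hnn : ∀ p, 0 ≤ w p * (h p * timeCutoff t₁ p.2) := fun p =>
    mul_nonneg (hw0 p) (mul_nonneg (Real.exp_nonneg _) (timeCutoff_nonneg _ _))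
  have hgi : Integrable fun p => w p * (h p * timeCutoff t₁ p.2) := by
    refine (hint.mul_const (B * C)).mono' (hwl.aestronglyMeasurable.mul
      (hhc.mul (hχc.comp continuous_snd)).aestronglyMeasurable) ?_
    filter_upwards [ae_all_iff.2 hbound] with p hp
    rw [← norm_neg]
    exact le_of_tendsto' (hpt p).norm hp
  have hz := (integral_eq_zero_iff_of_nonneg hnn hgi).1 (le_antisymm hle (integral_nonneg hnn))
  filter_upwards [hz] with p hp hpt₁
  rcases le_or_gt p.2 0 with hneg | hpos
  · exact hwt p hneg
  · have hχ := timeCutoff_pos (abs_lt.2 ⟨by linarith, hpt₁⟩ : |p.2| < t₁)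
    exact (mul_eq_zero.1 hp).resolve_right (mul_pos (Real.exp_pos _) hχ).ne'

/-- A nonnegative subsolution of Gaussian growth with zero initial data vanishes. -/
theorem IsHeatSubsolution.ae_eq_zero {T l : ℝ} {w : SpaceTime n → ℝ}
    (hw : IsHeatSubsolution T w) (hw0 : ∀ p, 0 ≤ w p) (hwl : LocallyIntegrable w)
    (hwt : ∀ p, p.2 ≤ 0 → w p = 0) (hl : 0 < l)
    (hint : Integrable fun p => Real.exp (-l * ‖p.1‖ ^ 2) * w p) :
    ∀ᵐ p : SpaceTime n, p.2 < T → w p = 0 := by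
  have hτ : 0 < 1 / (16 * l) := by positivity
  have key : ∀ k : ℕ, ∀ t₁ : ℝ, t₁ < T → t₁ ≤ k * (1 / (16 * l)) →
      ∀ᵐ p : SpaceTime n, p.2 < t₁ → w p = 0 := by
    intro k
    induction k with
    | zero =>
      intro t₁ _ ht₁
      rw [Nat.cast_zero, zero_mul] at ht₁
      exact Eventually.of_forall fun p hp => hwt p (hp.le.trans ht₁)
    | succ k ih =>
      intro t₁ htT ht₁
      rcases le_or_gt t₁ 0 with hneg | hpos
      · exact Eventually.of_forall fun p hp => hwt p (hp.le.trans hneg)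
      push_cast at ht₁
      -- The earlier time `t₀` may be negative; the induction hypothesis still covers it.
      exact hw.ae_eq_zero_step (t₀ := t₁ - 1 / (16 * l)) hw0 hwl hwt hl hint hpos htT
        (by linarith) (ih _ (by linarith) (by linarith))
  -- Each step needs its end time strictly below `T`, so that the barrier is supported in `{t < T}`;
  -- `T` itself is reached through a sequence.
  have key' : ∀ m : ℕ, ∀ᵐ p : SpaceTime n, p.2 < T - 1 / ((m : ℝ) + 1) → w p = 0 := fun m => by
    obtain ⟨k, hk⟩ := exists_nat_ge ((T - 1 / ((m : ℝ) + 1)) / (1 / (16 * l)))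
    refine key k _ (sub_lt_self _ (by positivity)) ?_
    rwa [div_le_iff₀ hτ] at hk
  filter_upwards [ae_all_iff.2 key'] with p hp hpT
  obtain ⟨m, hm⟩ := exists_nat_one_div_lt (sub_pos.2 hpT)
  exact hp m (by linarith)

/-- The factor `1 + V` is at least `1` and can be dropped. Integrability for every larger rate lets
two solutions share one rate. -/
theorem InClassE.integrableOn_exp_mul_abs {T : ℝ} {V u : SpaceTime n → ℝ} (h : InClassE T V u)
    (hV : ∀ᵐ p ∂volume.restrict (Q n T), 0 ≤ V p)
    (hu : AEStronglyMeasurable u (volume.restrict (Q n T))) :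
    ∃ l, 0 < l ∧ ∀ l', l ≤ l' →
      IntegrableOn (fun p => Real.exp (-l' * ‖p.1‖ ^ 2) * |u p|) (Q n T) := by
  obtain ⟨l, hl, hi⟩ := h
  refine ⟨l, hl, fun l' hl' => Integrable.mono' hi ?_ ?_⟩
  · have hc : Continuous fun p : SpaceTime n => Real.exp (-l' * ‖p.1‖ ^ 2) := by fun_prop
    exact hc.aestronglyMeasurable.mul hu.norm
  · filter_upwards [hV] with p hp
    have h1 : Real.exp (-l' * ‖p.1‖ ^ 2) ≤ Real.exp (-l * ‖p.1‖ ^ 2) :=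
      Real.exp_le_exp.2 (mul_le_mul_of_nonneg_right (neg_le_neg hl') (sq_nonneg _))
    have h2 : 0 ≤ Real.exp (-l * ‖p.1‖ ^ 2) * |u p| :=
      mul_nonneg (Real.exp_nonneg _) (abs_nonneg _)
    rw [norm_mul, Real.norm_eq_abs, Real.norm_eq_abs, abs_abs, Real.abs_exp]
    calc Real.exp (-l' * ‖p.1‖ ^ 2) * |u p| ≤ Real.exp (-l * ‖p.1‖ ^ 2) * |u p| :=
          mul_le_mul_of_nonneg_right h1 (abs_nonneg _)
      _ ≤ Real.exp (-l * ‖p.1‖ ^ 2) * |u p| * (1 + V p) :=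
          le_mul_of_one_le_right h2 (by linarith)

/-- Weak solutions in the class `ℰ_V(Q_T)` are unique. -/
theorem IsWeakSolution.ae_eq {T : ℝ} {V u₁ u₂ : SpaceTime n → ℝ} {μ : SignedRadonMeasure n}
    (hV : ∀ᵐ p ∂volume.restrict (Q n T), 0 ≤ V p)
    (h₁ : IsWeakSolution T V μ u₁) (hE₁ : InClassE T V u₁)
    (h₂ : IsWeakSolution T V μ u₂) (hE₂ : InClassE T V u₂) :
    ∀ᵐ p ∂volume.restrict (Q n T), u₁ p = u₂ p := by
  have hQm := (isOpen_Q n T).measurableSet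
  set U := (Q n T).indicator fun p => u₁ p - u₂ p with hU
  have hUl : LocallyIntegrable U :=
    locallyIntegrable_indicator_Q (h₁.locallyIntegrable.sub h₂.locallyIntegrable)
  have hHl : LocallyIntegrable ((Q n T).indicator fun p => V p * u₁ p - V p * u₂ p) :=
    locallyIntegrable_indicator_Q
      (h₁.locallyIntegrable_potential.sub h₂.locallyIntegrable_potential)
  have hsub : IsHeatSubsolution T fun p => |U p| := by
    intro φ hφ hφs hφT hφ0
    refine (h₁.isDistribSolution_sub h₂).integral_abs_nonneg
      (isOpen_lt continuous_snd continuous_const) hUl hHl ?_ hφ hφs hφT hφ0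
    filter_upwards [(ae_restrict_iff' hQm).1 hV] with p hp
    by_cases hpQ : p ∈ Q n T
    · rw [indicator_of_mem hpQ, indicator_of_mem hpQ]
      -- The product to be bounded below is `V (u₁ - u₂)²`.
      nlinarith [mul_nonneg (hp hpQ) (sq_nonneg (u₁ p - u₂ p))]
    · simp [indicator_of_notMem hpQ]
  have hm : ∀ u : SpaceTime n → ℝ, LocallyIntegrableOn u (closedQ n T) →
      AEStronglyMeasurable u (volume.restrict (Q n T)) := fun u hu =>
    hu.aestronglyMeasurable.mono_set (Q_subset_closedQ n T)
  obtain ⟨l₁, hl₁, hi₁⟩ := hE₁.integrableOn_exp_mul_abs hV (hm u₁ h₁.locallyIntegrable)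
  obtain ⟨l₂, hl₂, hi₂⟩ := hE₂.integrableOn_exp_mul_abs hV (hm u₂ h₂.locallyIntegrable)
  set l := max l₁ l₂ with hl
  have hint : Integrable fun p : SpaceTime n => Real.exp (-l * ‖p.1‖ ^ 2) * |U p| := by
    have h0 : IntegrableOn (fun p => Real.exp (-l * ‖p.1‖ ^ 2) * |u₁ p - u₂ p|) (Q n T) := by
      have hc : Continuous fun p : SpaceTime n => Real.exp (-l * ‖p.1‖ ^ 2) := by fun_prop
      refine ((hi₁ l (le_max_left _ _)).add (hi₂ l (le_max_right _ _))).mono'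
        (hc.aestronglyMeasurable.mul
          ((hm u₁ h₁.locallyIntegrable).sub (hm u₂ h₂.locallyIntegrable)).norm)
        (Eventually.of_forall fun p => ?_)
      rw [norm_mul, Real.norm_eq_abs, Real.norm_eq_abs, abs_abs, Real.abs_exp]
      simp only [Pi.add_apply, ← mul_add]
      exact mul_le_mul_of_nonneg_left (abs_sub _ _) (Real.exp_nonneg _)
    refine (h0.integrable_indicator hQm).congr (Eventually.of_forall fun p => ?_)
    by_cases hpQ : p ∈ Q n T
    · simp [hU, indicator_of_mem hpQ]
    · simp [hU, indicator_of_notMem hpQ]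
  have hzero := hsub.ae_eq_zero (fun p => abs_nonneg _)
    (fun x => let ⟨s, hs, hi⟩ := hUl x; ⟨s, hs, hi.norm⟩) (fun p hp => by
    have : p ∉ Q n T := fun h => not_lt.2 hp h.2.1
    simp [hU, indicator_of_notMem this]) (hl₁.trans_le (le_max_left l₁ l₂)) hint
  rw [ae_restrict_iff' hQm]
  filter_upwards [hzero] with p hp hpQ
  have := abs_eq_zero.1 (hp hpQ.2.2)
  rw [hU, indicator_of_mem hpQ] at this
  exact sub_eq_zero.1 this

/-- Comparison with this solution turns uniqueness into the homogeneous statement. -/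
theorem isWeakSolution_zero (T : ℝ) (V : SpaceTime n → ℝ) :
    IsWeakSolution T V (0 : SignedRadonMeasure n) fun _ => 0 where
  locallyIntegrable := (locallyIntegrable_zero (μ := volume)).locallyIntegrableOn _
  locallyIntegrable_potential := by
    simpa using (locallyIntegrable_zero (μ := volume)).locallyIntegrableOn _
  weakForm φ g _ := by
    have hp : (0 : SignedRadonMeasure n).posPart = 0 := rfl
    have hn : (0 : SignedRadonMeasure n).negPart = 0 := rfl
    simp [SignedRadonMeasure.integral, hp, hn]

theorem inClassE_zero (T : ℝ) (V : SpaceTime n → ℝ) : InClassE T V fun _ => 0 :=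
  ⟨1, one_pos, by simp [IntegrableOn]⟩

end Uniqueness

end HeatPotential

end

theorem lemma2p4 (n : ℕ) (T : ℝ) (hT : 0 < T) (V : HeatPotential.SpaceTime n → ℝ)
    (hV_loc : MeasureTheory.LocallyIntegrableOn V (HeatPotential.Q n T))
    (hV_nonneg : ∀ᵐ p ∂MeasureTheory.volume.restrict (HeatPotential.Q n T), 0 ≤ V p) :
    (∀ (μ : HeatPotential.SignedRadonMeasure n) (u₁ u₂ : HeatPotential.SpaceTime n → ℝ),
      HeatPotential.IsWeakSolution T V μ u₁ → HeatPotential.InClassE T V u₁ →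
      HeatPotential.IsWeakSolution T V μ u₂ → HeatPotential.InClassE T V u₂ →
        ∀ᵐ p ∂MeasureTheory.volume.restrict (HeatPotential.Q n T), u₁ p = u₂ p) ∧
    (∀ u : HeatPotential.SpaceTime n → ℝ,
      HeatPotential.IsWeakSolution T V 0 u → HeatPotential.InClassE T V u →
        ∀ᵐ p ∂MeasureTheory.volume.restrict (HeatPotential.Q n T), u p = 0) := by
  have key := fun (μ : HeatPotential.SignedRadonMeasure n) (u₁ u₂ : HeatPotential.SpaceTime n → ℝ)
      h₁ hE₁ h₂ hE₂ =>
    HeatPotential.IsWeakSolution.ae_eq (μ := μ) (u₁ := u₁) (u₂ := u₂) hV_nonneg h₁ hE₁ h₂ hE₂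
  exact ⟨key, fun u hu hE => key 0 u _ hu hE (HeatPotential.isWeakSolution_zero T V)
    (HeatPotential.inClassE_zero T V)⟩
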